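/- Let $k\ge 1$ be an integer, $\mu\in\mathbb C\setminus\mathbb R_{\le 0}$, $0<\beta<\frac{\pi}{2k}$, $r>0$, and let $\nu\in\mathbb R$ satisfy $\operatorname{Re}\mu>\nu\operatorname{Im}\mu$. *Sectors.* For $j\in\mathbb Z/k\mathbb Z$ put $\theta^j=\frac{2\pi j}{k}$ and let $V^j$ be the union of the sector $\{0<|x|<r,\ |\arg x-\theta^j|<\frac{\pi}{k}+\beta\}$ and of the domain $\{|x|\ge r,\ |\arg x-\nu\log\frac{|x|}{r}-\theta^j|<\frac{\pi}{k}+\beta\}$ bounded by two spirals. Its boundary curves, oriented from $0$ to $\infty$, are $\Gamma^{j,\pm}=\{\arg x-\nu\max(0,\log\frac{|x|}{r})=\theta^j\pm(\frac{\pi}{k}+\beta)\}$. Intersections are understood on the Riemann surface of the logarithm (the sectors $V^j$ and $V^{j+k}$ being identified through $\arg\mapsto\arg+2\pi$): $V^{j,s}=V^j\cap V^{j+1}$ is the component of arguments around $\frac{(2j+1)\pi}{k}$; if $k=1$, $V^0$ overlaps with itself without gluing and $V^{0,s}$ is the overlap. For $\rho\in\,]0,+\infty]$ let $\mathcal V_\rho^{j}=V^j\times\{|y|<\rho\}$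 and $\mathcal V_\rho^{j,s}=V^{j,s}\times\{|y|<\rho\}$. *Function spaces.* $\mathcal B((\mathcal V_\rho^j)_j)$ is the space of collections $N=(N^j)_j$ of bounded holomorphic functions $N^j$ on $\mathcal V_\rho^j$, with norm $\|N\|=\max_j\sup|N^j|$. A collection $\Delta=(\Delta^j)_{j\in\mathbb Z/k\mathbb Z}$ of domains of $\mathbb C$ containing $0$ is called admissible; $\mathcal B'(\Delta)$ is the space of collections $\varphi=(\varphi^j)_j$ of holomorphic functions $\varphi^j$ on $\Delta^j$ with $\varphi^j(0)=0$ and $\sup_{h\in\Delta^j\setminus\{0\}}|\varphi^j(h)|/|h|<\infty$. *First integrals.* For $N\in\mathcal B((\mathcal V_\rho^j)_j)$ put $$H_N^j(x,y)=y\,e^{2i\pi j\mu/k}\exp\Big(\frac{1}{kx^k}-\mu\log x+N^j(x,y)\Big),\qquad (x,y)\in\mathcal V^j_\rho,$$ with the determination of $\log$ on $V^j$ for which $|\arg x-\theta^j|<\frac{\pi}{k}+\beta$ for small $x$. The couple $(\rho,N)$ is adapted to $\Delta$ if $H_N^j(\mathcal V_\rho^{j,s})\subset\Delta^j$ for all $j$.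 *Refined Cauchy–Heine transform.* For $(\rho,N)$ adapted to $\Delta$ with $\rho<\infty$ and $f\in\mathcal B'(\Delta)$, let $\Sigma(N,f)=(\Sigma^j)_j$ with $$\Sigma^j(x,y)=\frac{x}{2i\pi}\sum_{\ell\ne j}\int_{\Gamma^{\ell+1,-}}\frac{f^{\ell}(H_N^{\ell}(z,y))}{z(z-x)}\,dz+\frac{x}{2i\pi}\int_{\Gamma^{j,+}}\frac{f^j(H_N^j(z,y))}{z(z-x)}\,dz,\qquad(x,y)\in\mathcal V_\rho^j.$$ Here an integral carrying the index $\ell$ is, precisely, the absolutely convergent integral along any curve $\{\arg z-\nu\max(0,\log\frac{|z|}{r})=\frac{(2\ell+1)\pi}{k}+\delta_\ell\}$ in $V^{\ell,s}$ with $|\delta_\ell|<\beta$, where the $\delta_\ell$ ($\ell\in\mathbb Z/k\mathbb Z$) are such that $\frac{(2j-1)\pi}{k}+\delta_{j-1}<\arg x-\nu\max(0,\log\frac{|x|}{r})<\frac{(2j+1)\pi}{k}+\delta_j$; the value is the same for all such choices. **Proposition.** Let $\Delta$ be admissible and $\varphi\in\mathcal B'(\Delta)$. Then there exist $0<\rho<\infty$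 and $N\in\mathcal B((\mathcal V_\rho^j)_j)$ such that $(\rho,N)$ is adapted to $\Delta$ and 1. for every $j\in\mathbb Z/k\mathbb Z$, on $\mathcal V_\rho^{j,s}$, $$H_N^{j+1}=H_N^j\exp\Big(\frac{2i\pi\mu}{k}+\varphi^j(H_N^j)\Big);$$ 2. $\Big\|y\dfrac{\partial N}{\partial y}\Big\|<1$ and $\Big\|x\dfrac{\partial N}{\partial x}\Big\|<1$; 3. $N$ is the limit of the iteration $N_0=0$, $N_{n+1}=\Sigma(N_n,\varphi)$: for every $n$ the transform $\Sigma(N_n,\varphi)$ is defined, $(\rho,N_n)$ being adapted to $\Delta$ with $N_n\in\mathcal B((\mathcal V_\rho^j)_j)$, and $N_n^j\to N^j$ locally uniformly on $\mathcal V_\rho^j$ for every $j$. -/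

import Mathlib

open scoped ENNReal

noncomputable section

namespace SaddleNode

/-! ### Sectors

The variable `x ≠ 0` is written `x = exp w`, so that `w = log x` is a point of the Riemann surface
of the logarithm, together with the determination of the logarithm used there. The sectors `V^j`
are described by the points `w` lying over them; the labels `j : ℤ` and `j + k` stand for the same
sector, described with determinations of the logarithm that differ by `2πi`.
For `2 ≤ k` the map `exp` is injective on each of these sectors, which are thus plane domains.
For `k = 1` the sector has an aperture greater than `2π` and overlaps with itself without gluing. -/

/-- The argument of `x = exp w`, corrected by the rotation of the spirals outside the disc of
radius `r`: it is `arg x` for `|x| ≤ r`, and it is constant on each spiral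
`a * exp ((1 + i ν) * t)`, `t ≥ 0`, with `|a| = r`. -/
def spiralArg (r ν : ℝ) (w : ℂ) : ℝ := w.im - ν * max 0 (w.re - Real.log r)

/-- The direction `θ^j = 2πj/k`. -/
def direction (k : ℕ) (j : ℤ) : ℝ := j * (2 * Real.pi / k)

/-- The sector `V^j`: a standard sector of aperture `2 (π/k + β)` bisected by `θ^j` in the disc of
radius `r`, continued outside the disc by the domain between two spirals. -/
def sector (k : ℕ) (β r ν : ℝ) (j : ℤ) : Set ℂ :=
  {w | |spiralArg r ν w - direction k j| < Real.pi / k + β}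

/-- The saddle-part `V^{j,s} = V^j ∩ V^{j+1}`. -/
def saddlePart (k : ℕ) (β r ν : ℝ) (j : ℤ) : Set ℂ :=
  sector k β r ν j ∩ sector k β r ν (j + 1)

/-- `𝒱_ρ^j = V^j × {|y| < ρ}`. -/
def sectorDom (k : ℕ) (β r ν : ℝ) (ρ : ℝ≥0∞) (j : ℤ) : Set (ℂ × ℂ) :=
  {p | p.1 ∈ sector k β r ν j ∧ ‖p.2‖ₑ < ρ}

/-- `𝒱_ρ^{j,s} = V^{j,s} × {|y| < ρ}`. -/
def saddleDom (k : ℕ) (β r ν : ℝ) (ρ : ℝ≥0∞) (j : ℤ) : Set (ℂ × ℂ) :=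
  {p | p.1 ∈ saddlePart k β r ν j ∧ ‖p.2‖ₑ < ρ}

/-! ### Function spaces -/

/-- The norm `max_j sup_{D_j} |F_j|` of a collection of functions (possibly infinite). -/
def supNorm {E : Type*} (D : ℤ → Set E) (F : ℤ → E → ℂ) : ℝ≥0∞ :=
  ⨆ j, ⨆ p ∈ D j, ‖F j p‖ₑ

/-- `N = (N^j)_j` belongs to `ℬ((𝒱_ρ^j)_j)`, where `j` runs through the integers modulo `k`. -/
structure MemB (k : ℕ) (β r ν : ℝ) (ρ : ℝ≥0∞) (N : ℤ → ℂ × ℂ → ℂ) : Prop where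
  holomorphic : ∀ j, DifferentiableOn ℂ (N j) (sectorDom k β r ν ρ j)
  bounded : supNorm (sectorDom k β r ν ρ) N < ⊤
  /-- `N^{j+k}` and `N^j` are the same function of `(x, y)`. -/
  periodic : ∀ j, ∀ p ∈ sectorDom k β r ν ρ j,
    N (j + k) (p.1 + 2 * Real.pi * Complex.I, p.2) = N j p

/-- An admissible collection: `k` domains of `ℂ` containing `0`. -/
def IsAdmissible {k : ℕ} (Δ : ZMod k → Set ℂ) : Prop :=
  ∀ j, IsOpen (Δ j) ∧ IsConnected (Δ j) ∧ (0 : ℂ) ∈ Δ j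

/-- `φ = (φ^j)_j` belongs to `ℬ'(Δ)`: each `φ^j` is holomorphic on `Δ^j`, vanishes at `0`, and
`|φ^j(h)| / |h|` is bounded on `Δ^j`. -/
def MemBPrime {k : ℕ} (Δ : ZMod k → Set ℂ) (φ : ZMod k → ℂ → ℂ) : Prop :=
  ∀ j, DifferentiableOn ℂ (φ j) (Δ j) ∧ φ j 0 = 0 ∧ ∃ C : ℝ, ∀ h ∈ Δ j, ‖φ j h‖ ≤ C * ‖h‖

/-! ### First integrals and adapted couples -/

/-- The sectorial first-integrals
`H_N^j(x, y) = y exp(2πijμ/k) exp(1/(k x^k) - μ log x + N^j(x, y))`, with `x = exp w`. -/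
def firstIntegral (k : ℕ) (μ : ℂ) (N : ℤ → ℂ × ℂ → ℂ) (j : ℤ) (p : ℂ × ℂ) : ℂ :=
  p.2 * Complex.exp (2 * Complex.I * Real.pi * j * μ / k) *
    Complex.exp (1 / (k * Complex.exp p.1 ^ k) - μ * p.1 + N j p)

/-- `(ρ, N)` is adapted to `Δ`. -/
structure IsAdapted (k : ℕ) (μ : ℂ) (β r ν : ℝ) (Δ : ZMod k → Set ℂ)
    (ρ : ℝ≥0∞) (N : ℤ → ℂ × ℂ → ℂ) : Prop where
  pos : 0 < ρ
  mem : MemB k β r ν ρ N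
  mapsTo : ∀ j : ℤ,
    Set.MapsTo (firstIntegral k μ N j) (saddleDom k β r ν ρ j) (Δ (j : ZMod k))

/-- `∂F/∂y`. -/
def partialY (F : ℂ × ℂ → ℂ) (p : ℂ × ℂ) : ℂ := deriv (fun y => F (p.1, y)) p.2

/-- `∂F/∂x`, where `x = exp w`, that is `(dx/dw)⁻¹ ∂F/∂w`. -/
def partialX (F : ℂ × ℂ → ℂ) (p : ℂ × ℂ) : ℂ :=
  (Complex.exp p.1)⁻¹ * deriv (fun w => F (w, p.2)) p.1

/-! ### The refined Cauchy-Heine transform -/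

/-- The path from `0` to `∞` (in the coordinate `log z`) consisting of the segment of argument `c`
in the disc of radius `r`, followed by a spiral. The boundary curves `Γ^{j,±}` of `V^j` are
obtained for `c = θ^j ± (π/k + β)`. -/
def contour (r ν c t : ℝ) : ℂ := ⟨t, c + ν * max 0 (t - Real.log r)⟩

/-- The derivative with respect to `t` of the path `contour r ν c`. -/
def contourSpeed (r ν t : ℝ) : ℂ := if t < Real.log r then 1 else 1 + Complex.I * ν

/-- The pull-back to the parameter `t` of the form `f^ℓ(H_N^ℓ(z, y)) / (z (z - x)) dz` on the path
of argument `(2ℓ+1)π/k + δ`; this path lies in `V^{ℓ,s}` if `|δ| < β`, and it tends to the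
boundary curve `Γ^{ℓ,+}` as `δ → β`, and to `Γ^{ℓ+1,-}` as `δ → -β`. -/
def cauchyHeineIntegrand (k : ℕ) (μ : ℂ) (r ν : ℝ) (N : ℤ → ℂ × ℂ → ℂ) (f : ZMod k → ℂ → ℂ)
    (ℓ : ℤ) (δ : ℝ) (x y : ℂ) (t : ℝ) : ℂ :=
  let ζ : ℂ := contour r ν ((2 * ℓ + 1) * Real.pi / k + δ) t
  let z : ℂ := Complex.exp ζ
  f (ℓ : ZMod k) (firstIntegral k μ N ℓ (ζ, y)) / (z * (z - x)) * (z * contourSpeed r ν t)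

/-- `S = Σ(N, f)` is the refined Cauchy-Heine transform of `f` associated to `N`, on `𝒱_ρ^j`:
`S^j(x, y) = x/(2πi) ∑_ℓ ∫ f^ℓ(H_N^ℓ(z, y)) / (z (z - x)) dz`, where for each `ℓ` modulo `k` the
integral is absolutely convergent and taken over a path in `V^{ℓ,s}`, the paths being such that
`x` lies above the one in `V^{j-1,s}` and below the one in `V^{j,s}`. The value is the same for all
such paths, in particular for those arbitrarily close to `Γ^{j,+}` for `ℓ = j` and to `Γ^{ℓ+1,-}`
for the other `ℓ`. -/
def IsCauchyHeine (k : ℕ) (μ : ℂ) (β r ν : ℝ) (ρ : ℝ≥0∞) (N : ℤ → ℂ × ℂ → ℂ)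
    (f : ZMod k → ℂ → ℂ) (S : ℤ → ℂ × ℂ → ℂ) : Prop :=
  ∀ j : ℤ, ∀ p ∈ sectorDom k β r ν ρ j, ∀ δ : ZMod k → ℝ, (∀ ℓ, |δ ℓ| < β) →
    (2 * j - 1) * Real.pi / k + δ ((j - 1 : ℤ) : ZMod k) < spiralArg r ν p.1 →
    spiralArg r ν p.1 < (2 * j + 1) * Real.pi / k + δ (j : ZMod k) →
    (∀ ℓ ∈ Finset.range k, MeasureTheory.Integrable
      (cauchyHeineIntegrand k μ r ν N f ℓ (δ (ℓ : ZMod k)) (Complex.exp p.1) p.2)) ∧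
    S j p = Complex.exp p.1 / (2 * Complex.I * Real.pi) *
      ∑ ℓ ∈ Finset.range k,
        ∫ t : ℝ, cauchyHeineIntegrand k μ r ν N f ℓ (δ (ℓ : ZMod k)) (Complex.exp p.1) p.2 t

end SaddleNode

end

open scoped ENNReal

noncomputable section
namespace SaddleNode

open Complex Filter Topology MeasureTheory Set

/-! ### Spiral coordinates -/

/-! The iteration converges because `Σ(·, φ)` is a contraction for small `ρ`, and its limit solves
the gluing problem because `Σ(N, φ)` jumps by `φ^j(H_N^j)` across `V^{j,s}`: in terms of `N`, the
relation between first integrals reads `N^{j+1} - N^j = φ^j(H_N^j)`.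

In the coordinate `w = log x`, the form `x dz / (z (z - x))` becomes `dζ / (e^{ζ-w} - 1)`, which is
`2πi`-periodic in `w` and has residue `1` at `ζ = w`. Each term of `Σ` is thus the transform
`cauchyHeine` of a function `g` that is holomorphic and `O(e^{-α|Re ζ|})` on a spiral strip of
half-width `β` around some argument `c`. Since the path may move inside the strip
(`spiralIntegral_eq_of_decay`), this transform is holomorphic in `w` for arguments in `(c - β - 2π,
c + β)`. That interval is longer than `2π`, and the values at `w - 2πi` and `w` differ by `g(w)`
(`cauchyHeine_sub_two_pi_I`). With the representatives `ℓ = j, …, j+k-1`, all the terms of `Σ^j`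
live on `V^j`, and `Σ^{j+1} - Σ^j` telescopes to this jump (`cauchyHeineSum_jump`).

The decay comes from `H` (`exists_norm_modelIntegral_le`): on the saddle-parts `Re x^{-k}` tends to
`-∞` at `0` because `kβ < π/2`, and `|x^{-μ}|` is comparable to `|x|^{-α}` along the spirals, with
`α = Re μ - ν Im μ > 0`. As `H` carries the factor `y`, it is `O(ρ)` for `|N| ≤ 1`. By
`exists_norm_cauchyHeine_le`, one number `q = O(ρ)` then bounds both `Σ(N, φ)` and its Lipschitz
constant in `N`.

For the derivatives, the iteration is run on a larger domain, with `β' > β` and twice the radius in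
`y`. There `|N| ≤ q`, and Cauchy's estimates apply, `x ∂/∂x` being `∂/∂w`. -/

lemma spiralArg_contour (r ν c t : ℝ) : spiralArg r ν (contour r ν c t) = c := by
  simp [spiralArg, contour]

lemma contour_re (r ν c t : ℝ) : (contour r ν c t).re = t := rfl

lemma contour_spiralArg (r ν : ℝ) (w : ℂ) : contour r ν (spiralArg r ν w) w.re = w := by
  apply Complex.ext <;> simp [spiralArg, contour]

lemma contour_eq (r ν c t : ℝ) :
    contour r ν c t = t + c * I + (ν * max 0 (t - Real.log r) : ℝ) * I := by
  apply Complex.ext <;> simp [contour]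

lemma contour_add (r ν c d t : ℝ) : contour r ν (c + d) t = contour r ν c t + d * I := by
  simp only [contour_eq]; push_cast; ring

lemma spiralArg_add_mul_I (r ν : ℝ) (w : ℂ) (d : ℝ) :
    spiralArg r ν (w + d * I) = spiralArg r ν w + d := by
  simp [spiralArg]; ring

/-- This Lipschitz constant tells which discs of the `log` plane fit into a spiral strip, as needed
for Cauchy's estimates. -/
lemma abs_spiralArg_sub_le (r ν : ℝ) (z w : ℂ) :
    |spiralArg r ν z - spiralArg r ν w| ≤ (1 + |ν|) * ‖z - w‖ := by
  have h1 : |z.im - w.im| ≤ ‖z - w‖ := by simpa using Complex.abs_im_le_norm (z - w)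
  have h2 : |z.re - w.re| ≤ ‖z - w‖ := by simpa using Complex.abs_re_le_norm (z - w)
  have h3 : |max 0 (z.re - Real.log r) - max 0 (w.re - Real.log r)| ≤ |z.re - w.re| := by
    have := abs_max_sub_max_le_abs (z.re - Real.log r) (w.re - Real.log r) 0
    rw [max_comm 0, max_comm 0]
    simpa using this
  have h4 : spiralArg r ν z - spiralArg r ν w = (z.im - w.im)
      - ν * (max 0 (z.re - Real.log r) - max 0 (w.re - Real.log r)) := by
    simp only [spiralArg]; ring
  rw [h4]
  refine (abs_sub _ _).trans ?_
  rw [abs_mul, add_mul, one_mul]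
  exact add_le_add h1 (mul_le_mul_of_nonneg_left (h3.trans h2) (abs_nonneg _))

lemma continuous_spiralArg (r ν : ℝ) : Continuous (spiralArg r ν) := by
  unfold spiralArg; fun_prop

/-- The open spiral strip between the paths of arguments `a` and `b`. -/
def strip (r ν a b : ℝ) : Set ℂ := spiralArg r ν ⁻¹' Ioo a b

lemma isOpen_strip (r ν a b : ℝ) : IsOpen (strip r ν a b) :=
  isOpen_Ioo.preimage (continuous_spiralArg r ν)

lemma mem_strip {r ν a b : ℝ} {w : ℂ} :
    w ∈ strip r ν a b ↔ a < spiralArg r ν w ∧ spiralArg r ν w < b := Iff.rfl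

lemma contour_mem_strip {r ν a b c : ℝ} (t : ℝ) (hc : c ∈ Ioo a b) :
    contour r ν c t ∈ strip r ν a b := by
  rw [mem_strip, spiralArg_contour]; exact hc

lemma strip_mono {r ν a b a' b' : ℝ} (ha : a' ≤ a) (hb : b ≤ b') :
    strip r ν a b ⊆ strip r ν a' b' :=
  preimage_mono (Ioo_subset_Ioo ha hb)

lemma continuous_contour (r ν c : ℝ) : Continuous (contour r ν c) := by
  rw [show contour r ν c = _ from funext (contour_eq r ν c)]; fun_prop

lemma hasDerivAt_contour_left (r ν c t : ℝ) :
    HasDerivAt (fun c' : ℝ => contour r ν c' t) I c := by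
  simp only [contour_eq]
  have h : HasDerivAt (fun c' : ℝ => (c' : ℂ) * I) (1 * I) c := (ofRealCLM.hasDerivAt).mul_const I
  simpa using h

lemma hasDerivAt_contour {r ν c t : ℝ} (ht : t ≠ Real.log r) :
    HasDerivAt (contour r ν c) (contourSpeed r ν t) t := by
  have h0 : HasDerivAt (fun t : ℝ => (t : ℂ)) 1 t := ofRealCLM.hasDerivAt
  rcases lt_or_gt_of_ne ht with h | h
  · have : contour r ν c =ᶠ[𝓝 t] fun t => (t : ℂ) + c * I := by
      filter_upwards [Iio_mem_nhds h] with s hs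
      rw [contour_eq, max_eq_left (sub_nonpos.2 (le_of_lt hs))]; simp
    rw [contourSpeed, if_pos h]
    exact (h0.add_const _).congr_of_eventuallyEq this
  · have : contour r ν c =ᶠ[𝓝 t] fun t => (t : ℂ) + c * I + (ν * I) * (t - Real.log r) := by
      filter_upwards [Ioi_mem_nhds h] with s hs
      rw [contour_eq, max_eq_right (sub_nonneg.2 (le_of_lt hs))]; push_cast; ring
    rw [contourSpeed, if_neg (not_lt.2 h.le)]
    convert! ((h0.add_const (c * I)).add ((h0.sub_const (Real.log r : ℂ)).const_mul
      (ν * I))).congr_of_eventuallyEq this using 1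
    ring

lemma measurable_contourSpeed (r ν : ℝ) : Measurable (contourSpeed r ν) :=
  Measurable.ite measurableSet_Iio measurable_const measurable_const

lemma norm_contourSpeed_le (r ν t : ℝ) : ‖contourSpeed r ν t‖ ≤ 1 + |ν| := by
  unfold contourSpeed
  split_ifs
  · simp
  · refine (norm_add_le _ _).trans ?_
    simp

/-- The path has a corner at `t = log r`, so the fundamental theorem of calculus is applied on each
side of it. -/
lemma contour_tendsto_integral (r ν c : ℝ) {Φ Φ' : ℂ → ℂ} {a b : ℂ}
    (hΦ : ∀ t, HasDerivAt Φ (Φ' (contour r ν c t)) (contour r ν c t))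
    (hint : Integrable fun t => Φ' (contour r ν c t) * contourSpeed r ν t)
    (ha : Tendsto (fun t => Φ (contour r ν c t)) atBot (𝓝 a))
    (hb : Tendsto (fun t => Φ (contour r ν c t)) atTop (𝓝 b)) :
    ∫ t, Φ' (contour r ν c t) * contourSpeed r ν t = b - a := by
  have hc : Continuous fun t => Φ (contour r ν c t) :=
    continuous_iff_continuousAt.2 fun t =>
      ContinuousAt.comp (f := contour r ν c) (hΦ t).continuousAt
        (continuous_contour r ν c).continuousAt
  have hd : ∀ t, t ≠ Real.log r → HasDerivAt (fun t => Φ (contour r ν c t))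
      (Φ' (contour r ν c t) * contourSpeed r ν t) t := fun t ht =>
    (hΦ t).comp t (hasDerivAt_contour ht)
  rw [← intervalIntegral.integral_Iic_add_Ioi (b := Real.log r) hint.integrableOn
    hint.integrableOn,
    integral_Iic_of_hasDerivAt_of_tendsto hc.continuousWithinAt (fun t ht => hd t (ne_of_lt ht))
      hint.integrableOn ha,
    integral_Ioi_of_hasDerivAt_of_tendsto hc.continuousWithinAt (fun t ht => hd t (ne_of_gt ht))
      hint.integrableOn hb]
  ring

/-! ### Exponentially decaying integrands on spiral strips -/

lemma integrable_exp_neg_mul_abs {a : ℝ} (ha : 0 < a) :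
    Integrable fun t : ℝ => Real.exp (-a * |t|) := by
  rw [← integrableOn_univ, ← Iic_union_Ioi (a := (0 : ℝ)), integrableOn_union]
  constructor
  · refine (integrableOn_exp_mul_Iic ha 0).congr_fun (fun t ht => ?_) measurableSet_Iic
    simp only [abs_of_nonpos (mem_Iic.1 ht)]; ring_nf
  · refine (integrableOn_exp_mul_Ioi (neg_lt_zero.2 ha) 0).congr_fun (fun t ht => ?_)
      measurableSet_Ioi
    simp only [abs_of_pos (mem_Ioi.1 ht)]

lemma tendsto_exp_neg_mul_abs_atTop {a : ℝ} (ha : 0 < a) :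
    Tendsto (fun t : ℝ => Real.exp (-a * |t|)) atTop (𝓝 0) :=
  Real.tendsto_exp_atBot.comp (tendsto_abs_atTop_atTop.const_mul_atTop_of_neg (neg_lt_zero.2 ha))

lemma tendsto_exp_neg_mul_abs_atBot {a : ℝ} (ha : 0 < a) :
    Tendsto (fun t : ℝ => Real.exp (-a * |t|)) atBot (𝓝 0) :=
  Real.tendsto_exp_atBot.comp (tendsto_abs_atBot_atTop.const_mul_atTop_of_neg (neg_lt_zero.2 ha))

/-- The integral of `F` along a spiral path. -/
def spiralIntegral (r ν c : ℝ) (F : ℂ → ℂ) : ℂ :=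
  ∫ t : ℝ, F (contour r ν c t) * contourSpeed r ν t

lemma aestronglyMeasurable_contour {r ν a b c : ℝ} {F : ℂ → ℂ}
    (hF : ContinuousOn F (strip r ν a b)) (hc : c ∈ Ioo a b) :
    AEStronglyMeasurable fun t => F (contour r ν c t) * contourSpeed r ν t :=
  (hF.comp_continuous (continuous_contour r ν c)
    fun t => contour_mem_strip t hc).aestronglyMeasurable.mul
      (measurable_contourSpeed r ν).aestronglyMeasurable

lemma integrable_contour {r ν a b c M α : ℝ} (hα : 0 < α) {F : ℂ → ℂ}
    (hF : ContinuousOn F (strip r ν a b)) (hc : c ∈ Ioo a b)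
    (hM : ∀ t, ‖F (contour r ν c t)‖ ≤ M * Real.exp (-α * |t|)) :
    Integrable fun t => F (contour r ν c t) * contourSpeed r ν t := by
  refine Integrable.mono' (((integrable_exp_neg_mul_abs hα).const_mul M).mul_const (1 + |ν|))
    (aestronglyMeasurable_contour hF hc) (Eventually.of_forall fun t => ?_)
  rw [norm_mul]
  exact mul_le_mul (hM t) (norm_contourSpeed_le r ν t) (norm_nonneg _)
    ((norm_nonneg _).trans (hM t))

lemma norm_spiralIntegral_le {r ν c M α : ℝ} (hα : 0 < α) {F : ℂ → ℂ}
    (hM : ∀ t, ‖F (contour r ν c t)‖ ≤ M * Real.exp (-α * |t|)) :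
    ‖spiralIntegral r ν c F‖ ≤ M * ((∫ t : ℝ, Real.exp (-α * |t|)) * (1 + |ν|)) := by
  rw [← mul_assoc, ← integral_const_mul, ← integral_mul_const]
  refine norm_integral_le_of_norm_le
    (((integrable_exp_neg_mul_abs hα).const_mul M).mul_const (1 + |ν|))
    (Eventually.of_forall fun t => ?_)
  rw [norm_mul]
  exact mul_le_mul (hM t) (norm_contourSpeed_le r ν t) (norm_nonneg _)
    ((norm_nonneg _).trans (hM t))

/-- A bound for large `|Re ζ|` is enough: the rest of a closed substrip is compact. This matters for
integrands with the Cauchy kernel, which may blow up at the edges of the open strip. -/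
lemma exists_decay_bound {r ν a b α M T : ℝ} {F : ℂ → ℂ}
    (hF : ContinuousOn F (strip r ν a b))
    (hM : ∀ ζ ∈ strip r ν a b, T ≤ |ζ.re| → ‖F ζ‖ ≤ M * Real.exp (-α * |ζ.re|))
    {a' b' : ℝ} (ha : a < a') (hb : b' < b) :
    ∃ M', 0 ≤ M' ∧
      ∀ ζ, spiralArg r ν ζ ∈ Icc a' b' → ‖F ζ‖ ≤ M' * Real.exp (-α * |ζ.re|) := by
  have hsub : Icc a' b' ⊆ Ioo a b := fun x hx => ⟨ha.trans_le hx.1, hx.2.trans_lt hb⟩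
  have hcont : ContinuousOn
      (fun p : ℝ × ℝ => F (contour r ν p.1 p.2) * (Real.exp (α * |p.2|) : ℂ))
      (Icc a' b' ×ˢ Icc (-T) T) := by
    refine ContinuousOn.mul (hF.comp ?_ ?_) (by fun_prop)
    · simp only [contour_eq]; fun_prop
    · exact fun p hp => contour_mem_strip _ (hsub hp.1)
  obtain ⟨C, hC⟩ := (isCompact_Icc.prod isCompact_Icc).exists_bound_of_continuousOn hcont
  refine ⟨max (max M C) 0, le_max_right _ _, fun ζ hζ => ?_⟩
  have key : ‖F ζ‖ ≤ max M C * Real.exp (-α * |ζ.re|) := by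
    rcases le_total T |ζ.re| with h | h
    · exact (hM ζ (hsub hζ) h).trans
        (mul_le_mul_of_nonneg_right (le_max_left _ _) (Real.exp_pos _).le)
    · have h1 := hC (spiralArg r ν ζ, ζ.re) ⟨hζ, abs_le.1 h⟩
      simp only [contour_spiralArg, norm_mul, norm_real, Real.norm_eq_abs, Real.abs_exp] at h1
      rw [neg_mul, Real.exp_neg, ← div_eq_mul_inv, le_div_iff₀ (Real.exp_pos _)]
      exact h1.trans (le_max_right _ _)
  exact key.trans (mul_le_mul_of_nonneg_right (le_max_left _ _) (Real.exp_pos _).le)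

lemma norm_deriv_le_of_decay {r ν a b α M d : ℝ} (hα : 0 < α) (hM0 : 0 ≤ M) {F : ℂ → ℂ}
    (hF : DifferentiableOn ℂ F (strip r ν a b))
    (hM : ∀ ζ ∈ strip r ν a b, ‖F ζ‖ ≤ M * Real.exp (-α * |ζ.re|)) (hd : 0 < d) {ζ : ℂ}
    (ha : a + (1 + |ν|) * d < spiralArg r ν ζ) (hb : spiralArg r ν ζ < b - (1 + |ν|) * d) :
    ‖deriv F ζ‖ ≤ M * Real.exp (α * d) / d * Real.exp (-α * |ζ.re|) := by
  have hsub : Metric.closedBall ζ d ⊆ strip r ν a b := fun z hz => by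
    have h1 := (abs_spiralArg_sub_le r ν z ζ).trans
      (mul_le_mul_of_nonneg_left (mem_closedBall_iff_norm.1 hz) (by positivity))
    rw [abs_le] at h1
    exact ⟨by linarith, by linarith⟩
  have h := norm_deriv_le_of_forall_mem_sphere_norm_le (f := F) (c := ζ) (R := d)
    (C := M * Real.exp (α * d) * Real.exp (-α * |ζ.re|)) hd
    (hF.diffContOnCl_ball hsub)
    (fun z hz => by
      refine (hM z (hsub (Metric.sphere_subset_closedBall hz))).trans ?_
      rw [mul_assoc, ← Real.exp_add]
      refine mul_le_mul_of_nonneg_left (Real.exp_le_exp.2 ?_) hM0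
      have h1 : |ζ.re - z.re| ≤ d := by
        have := Complex.abs_re_le_norm (ζ - z)
        rw [mem_sphere_iff_norm, norm_sub_rev] at hz
        simpa [hz] using this
      have h2 : |ζ.re| - |z.re| ≤ d := (abs_sub_abs_le_abs_sub _ _).trans h1
      nlinarith)
  rw [div_mul_eq_mul_div]; exact h

/-- The integral along a spiral path does not change when the path moves in a strip in which the
integrand is holomorphic and decays exponentially. -/
theorem spiralIntegral_eq_of_decay {r ν a b α M T : ℝ} (hα : 0 < α) {F : ℂ → ℂ}
    (hF : DifferentiableOn ℂ F (strip r ν a b))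
    (hM : ∀ ζ ∈ strip r ν a b, T ≤ |ζ.re| → ‖F ζ‖ ≤ M * Real.exp (-α * |ζ.re|))
    {c c' : ℝ} (hc : c ∈ Ioo a b) (hc' : c' ∈ Ioo a b) :
    spiralIntegral r ν c F = spiralIntegral r ν c' F := by
  -- Moving the path by `dc` translates it by `i dc`, so the derivative in `c` is `i ∫ F'(ζ) dζ`,
  -- which vanishes because `F` tends to `0` at both ends.
  have hd : ∀ c ∈ Ioo a b, HasDerivAt (fun c => spiralIntegral r ν c F) 0 c := by
    rintro c ⟨hca, hcb⟩
    obtain ⟨a', haa', ha'c⟩ := exists_between hca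
    obtain ⟨b', hcb', hb'b⟩ := exists_between hcb
    obtain ⟨M', hM'0, hM'⟩ := exists_decay_bound hF.continuousOn hM haa' hb'b
    obtain ⟨ε, hε, hε'⟩ : ∃ ε, 0 < ε ∧ ε < min (c - a') (b' - c) :=
      exists_between (lt_min (sub_pos.2 ha'c) (sub_pos.2 hcb'))
    rw [lt_min_iff] at hε'
    -- A disc of radius `d` around a point whose argument is within `ε` of `c` stays between `a'`
    -- and `b'`; Cauchy's estimate there dominates `F'`.
    set d := (min (c - a') (b' - c) - ε) / (1 + |ν|) / 2 with hd
    have hν : 0 < 1 + |ν| := by positivity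
    have hd0 : 0 < d := by
      have := lt_min hε'.1 hε'.2
      rw [hd]; apply div_pos _ two_pos; apply div_pos _ hν; linarith
    have hdν : (1 + |ν|) * d < min (c - a') (b' - c) - ε := by
      have : (1 + |ν|) * d = (min (c - a') (b' - c) - ε) / 2 := by rw [hd]; field_simp
      have := lt_min hε'.1 hε'.2
      linarith
    have hdν' := lt_min_iff.1 (lt_sub_iff_add_lt.1 hdν)
    have hF' : DifferentiableOn ℂ F (strip r ν a' b') := hF.mono (strip_mono haa'.le hb'b.le)
    have hbound : ∀ x ∈ Metric.ball c ε, ∀ t, ‖deriv F (contour r ν x t)‖ ≤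
        M' * Real.exp (α * d) / d * Real.exp (-α * |t|) := by
      intro x hx t
      rw [Metric.mem_ball, Real.dist_eq, abs_lt] at hx
      have := norm_deriv_le_of_decay hα hM'0 hF' (fun ζ hζ => hM' ζ ⟨hζ.1.le, hζ.2.le⟩) hd0
        (ζ := contour r ν x t) (by rw [spiralArg_contour]; linarith)
        (by rw [spiralArg_contour]; linarith)
      simpa [contour_re] using this
    have hball : Metric.ball c ε ⊆ Ioo a' b' := fun x hx => by
      rw [Metric.mem_ball, Real.dist_eq, abs_lt] at hx
      exact ⟨by linarith, by linarith⟩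
    have hcm : c ∈ Ioo a' b' := hball (Metric.mem_ball_self hε)
    have hmeas : AEStronglyMeasurable
        fun t => deriv F (contour r ν c t) * contourSpeed r ν t :=
      aestronglyMeasurable_contour (hF'.deriv (isOpen_strip _ _ _ _)).continuousOn hcm
    have hdiff : ∀ x ∈ Metric.ball c ε, ∀ t,
        HasDerivAt F (deriv F (contour r ν x t)) (contour r ν x t) := fun x hx t =>
      (hF'.differentiableAt ((isOpen_strip _ _ _ _).mem_nhds
        (contour_mem_strip t (hball hx)))).hasDerivAt
    have hdecay : ∀ x ∈ Metric.ball c ε, ∀ t,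
        ‖F (contour r ν x t)‖ ≤ M' * Real.exp (-α * |t|) := fun x hx t => by
      simpa [contour_re] using hM' (contour r ν x t)
        (by rw [spiralArg_contour]; exact Ioo_subset_Icc_self (hball hx))
    have hc0 := Metric.mem_ball_self (x := c) hε
    obtain ⟨h1, h2⟩ := hasDerivAt_integral_of_dominated_loc_of_deriv_le (𝕜 := ℝ) (μ := volume)
      (F := fun c t => F (contour r ν c t) * contourSpeed r ν t)
      (F' := fun c t => I * (deriv F (contour r ν c t) * contourSpeed r ν t))
      (bound := fun t => M' * Real.exp (α * d) / d * Real.exp (-α * |t|) * (1 + |ν|))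
      (Metric.ball_mem_nhds c hε)
      (by
        filter_upwards [Metric.ball_mem_nhds c hε] with x hx
        exact aestronglyMeasurable_contour hF'.continuousOn (hball hx))
      (integrable_contour hα hF'.continuousOn hcm (hdecay c hc0))
      (hmeas.const_mul I)
      (Eventually.of_forall fun t x hx => by
        rw [norm_mul, norm_I, one_mul, norm_mul]
        exact mul_le_mul (hbound x hx t) (norm_contourSpeed_le r ν t) (norm_nonneg _)
          ((norm_nonneg _).trans (hbound x hx t)))
      (((integrable_exp_neg_mul_abs hα).const_mul _).mul_const _)
      (Eventually.of_forall fun t x hx => by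
        convert! (((hdiff x hx t).comp x (hasDerivAt_contour_left r ν x t)).mul_const
          (contourSpeed r ν t)) using 1
        ring)
    have hz : ∫ t, I * (deriv F (contour r ν c t) * contourSpeed r ν t) = 0 := by
      rw [integral_const_mul, contour_tendsto_integral r ν c (Φ := F) (a := 0) (b := 0)
        (hdiff c hc0)]
      · simp
      · exact integrable_contour hα (hF'.deriv (isOpen_strip _ _ _ _)).continuousOn hcm
          (hbound c hc0)
      · refine squeeze_zero_norm (hdecay c hc0) ?_
        simpa using (tendsto_exp_neg_mul_abs_atBot hα).const_mul M'
      · refine squeeze_zero_norm (hdecay c hc0) ?_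
        simpa using (tendsto_exp_neg_mul_abs_atTop hα).const_mul M'
    rw [hz] at h2
    exact h2
  exact isOpen_Ioo.is_const_of_deriv_eq_zero isPreconnected_Ioo
    (fun x hx => (hd x hx).differentiableAt.differentiableWithinAt)
    (fun x hx => (hd x hx).deriv) hc hc'

/-! ### The Cauchy kernel in logarithmic coordinates -/

/-- The kernel `1 / (exp u - 1)`, that is `x dz / (z (z - x))` with `u = log z - log x`. -/
def kernel (u : ℂ) : ℂ := (exp u - 1)⁻¹

lemma kernel_add_two_pi_I (u : ℂ) : kernel (u + 2 * Real.pi * I) = kernel u := by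
  simp [kernel, exp_add, exp_two_pi_mul_I]

lemma exists_eq_add_of_exp_sub_eq_one (r ν : ℝ) {ζ w : ℂ} (h : exp (ζ - w) = 1) :
    ∃ n : ℤ, ζ = w + ((n * (2 * Real.pi) : ℝ) : ℂ) * I ∧
      spiralArg r ν ζ = spiralArg r ν w + n * (2 * Real.pi) := by
  obtain ⟨n, hn⟩ := exp_eq_one_iff.1 h
  have : ζ = w + ((n * (2 * Real.pi) : ℝ) : ℂ) * I := by
    push_cast; linear_combination hn
  exact ⟨n, this, by rw [this, spiralArg_add_mul_I]⟩

/-- The poles of the kernel are the points `w + 2πin`, whose spiral arguments differ from that of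
`w` by multiples of `2π`. -/
lemma exp_sub_ne_one {r ν : ℝ} {ζ w : ℂ} (h1 : spiralArg r ν w < spiralArg r ν ζ)
    (h2 : spiralArg r ν ζ < spiralArg r ν w + 2 * Real.pi) : exp (ζ - w) - 1 ≠ 0 := fun h => by
  obtain ⟨n, -, hn⟩ := exists_eq_add_of_exp_sub_eq_one r ν (sub_eq_zero.1 h)
  have hπ := Real.pi_pos
  have h3 : (0 : ℝ) < n := by
    by_contra! h; nlinarith
  have h4 : (n : ℝ) < 1 := by
    by_contra! h; nlinarith
  have : (0 : ℤ) < n := by exact_mod_cast h3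
  have : n < (1 : ℤ) := by exact_mod_cast h4
  omega

lemma eq_of_exp_sub_eq_one {r ν : ℝ} {ζ w : ℂ}
    (h1 : |spiralArg r ν ζ - spiralArg r ν w| < 2 * Real.pi) (h : exp (ζ - w) - 1 = 0) :
    ζ = w := by
  obtain ⟨n, hn', hn⟩ := exists_eq_add_of_exp_sub_eq_one r ν (sub_eq_zero.1 h)
  have hπ := Real.pi_pos
  rw [hn, add_sub_cancel_left, abs_mul, abs_of_pos (a := 2 * Real.pi) (by positivity)] at h1
  have h3 : |(n : ℝ)| < 1 := by
    by_contra! h; nlinarith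
  have : |n| < (1 : ℤ) := by exact_mod_cast h3
  rw [Int.abs_lt_one_iff.1 this] at hn'
  simpa using hn'

lemma abs_exp_re_sub_one_le (u : ℂ) : |Real.exp u.re - 1| ≤ ‖exp u - 1‖ := by
  have := abs_norm_sub_norm_le (exp u) 1
  rwa [norm_exp, norm_one] at this

lemma norm_kernel_le_of_le_abs_re {u : ℂ} {σ : ℝ} (hσ : 0 < σ) (hu : σ ≤ |u.re|) :
    ‖kernel u‖ ≤ (1 - Real.exp (-σ))⁻¹ := by
  have h0 : 0 < 1 - Real.exp (-σ) := sub_pos.2 (by simpa using hσ)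
  rw [kernel, norm_inv]
  refine inv_anti₀ h0 (le_trans ?_ (abs_exp_re_sub_one_le u))
  rcases le_abs.1 hu with h | h
  · have h1 := Real.exp_le_exp.2 h
    have h2 : Real.exp σ * Real.exp (-σ) = 1 := by rw [← Real.exp_add]; simp
    refine le_trans ?_ (le_abs_self _)
    nlinarith [Real.one_lt_exp_iff.2 hσ]
  · have h1 := Real.exp_le_exp.2 (show u.re ≤ -σ by linarith)
    refine le_trans ?_ (neg_le_abs _)
    linarith

lemma norm_kernel_le_two {u : ℂ} (hu : 1 ≤ |u.re|) : ‖kernel u‖ ≤ 2 := by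
  refine (norm_kernel_le_of_le_abs_re one_pos hu).trans ?_
  have h := Real.exp_one_gt_d9
  have : Real.exp (-1) ≤ 1 / 2 := by
    rw [Real.exp_neg, inv_le_comm₀ (Real.exp_pos _) (by norm_num)]; linarith
  rw [inv_le_comm₀ (by linarith) two_pos]
  linarith

/-- For `|Re u| ≥ σ` the kernel is bounded outright. For `|Re u| ≤ σ` the spirals shift the argument
by at most `|ν|σ ≤ η/2`, so `u` stays in a compact rectangle free of poles. -/
lemma exists_norm_kernel_le (r ν : ℝ) {η : ℝ} (hη : 0 < η) :
    ∃ C, 0 ≤ C ∧ ∀ ζ w : ℂ, spiralArg r ν w + η ≤ spiralArg r ν ζ →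
      spiralArg r ν ζ + η ≤ spiralArg r ν w + 2 * Real.pi → ‖kernel (ζ - w)‖ ≤ C := by
  set σ := η / (2 * (1 + |ν|)) with hσ
  have hν : 0 < 1 + |ν| := by positivity
  have hσ0 : 0 < σ := by positivity
  have hσν : |ν| * σ ≤ η / 2 := by
    have : (1 + |ν|) * σ = η / 2 := by rw [hσ]; field_simp
    linarith
  have hcont : ContinuousOn kernel (Icc (-σ) σ ×ℂ Icc (η / 2) (2 * Real.pi - η / 2)) := by
    refine ContinuousOn.inv₀ (by fun_prop) fun u hu h => ?_
    have h1 := mem_reProdIm.1 hu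
    obtain ⟨n, hn⟩ := exp_eq_one_iff.1 (sub_eq_zero.1 h)
    have him : u.im = n * (2 * Real.pi) := by rw [hn]; simp
    have hπ := Real.pi_pos
    have h3 : (0 : ℝ) < n := by
      by_contra! h; nlinarith [h1.2.1]
    have h4 : (n : ℝ) < 1 := by
      by_contra! h; nlinarith [h1.2.2]
    have : (0 : ℤ) < n := by exact_mod_cast h3
    have : n < (1 : ℤ) := by exact_mod_cast h4
    omega
  obtain ⟨C, hC⟩ := (isCompact_Icc.reProdIm isCompact_Icc).exists_bound_of_continuousOn hcont
  refine ⟨max (max C (1 - Real.exp (-σ))⁻¹) 0, le_max_right _ _, fun ζ w h1 h2 => ?_⟩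
  refine le_trans ?_ (le_max_left _ _)
  rcases le_total σ |(ζ - w).re| with h | h
  · exact (norm_kernel_le_of_le_abs_re hσ0 h).trans (le_max_right _ _)
  · refine (hC _ (mem_reProdIm.2 ⟨abs_le.1 h, ?_⟩)).trans (le_max_left _ _)
    have h3 : |max 0 (ζ.re - Real.log r) - max 0 (w.re - Real.log r)| ≤ |ζ.re - w.re| := by
      have := abs_max_sub_max_le_abs (ζ.re - Real.log r) (w.re - Real.log r) 0
      rw [max_comm 0, max_comm 0]
      simpa using this
    have h4 : (ζ - w).im = spiralArg r ν ζ - spiralArg r ν w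
        + ν * (max 0 (ζ.re - Real.log r) - max 0 (w.re - Real.log r)) := by
      simp only [spiralArg, sub_im]; ring
    have h5 : |ν * (max 0 (ζ.re - Real.log r) - max 0 (w.re - Real.log r))| ≤ η / 2 := by
      rw [abs_mul]
      refine le_trans (mul_le_mul_of_nonneg_left (h3.trans ?_) (abs_nonneg _)) hσν
      simpa using h
    rw [abs_le] at h5
    rw [h4]
    constructor <;> linarith

lemma differentiableAt_kernel {u : ℂ} (h : exp u - 1 ≠ 0) : DifferentiableAt ℂ kernel u := by
  unfold kernel
  exact DifferentiableAt.inv (by fun_prop) h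

lemma exp_neg_mul_abs_le {α α' : ℝ} (h : α' ≤ α) (t : ℝ) :
    Real.exp (-α * |t|) ≤ Real.exp (-α' * |t|) := by
  refine Real.exp_le_exp.2 ?_
  nlinarith [abs_nonneg t]

/-- Between the arguments of `w` and `w + 2πi` the kernel has no pole, and it is at most `2` once
`|Re ζ| ≥ |Re w| + 1`. -/
theorem spiralIntegral_mul_kernel_eq {r ν a b α M : ℝ} (hα : 0 < α) {g : ℂ → ℂ}
    (hg : DifferentiableOn ℂ g (strip r ν a b))
    (hM : ∀ ζ ∈ strip r ν a b, ‖g ζ‖ ≤ M * Real.exp (-α * |ζ.re|)) {w : ℂ} {c c' : ℝ}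
    (hc : c ∈ Ioo a b) (hc' : c' ∈ Ioo a b)
    (hcw : c ∈ Ioo (spiralArg r ν w) (spiralArg r ν w + 2 * Real.pi))
    (hcw' : c' ∈ Ioo (spiralArg r ν w) (spiralArg r ν w + 2 * Real.pi)) :
    spiralIntegral r ν c (fun ζ => g ζ * kernel (ζ - w)) =
      spiralIntegral r ν c' (fun ζ => g ζ * kernel (ζ - w)) := by
  refine spiralIntegral_eq_of_decay (a := max a (spiralArg r ν w))
    (b := min b (spiralArg r ν w + 2 * Real.pi)) (M := M * 2) (T := |w.re| + 1) hα ?_ ?_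
    ⟨max_lt hc.1 hcw.1, lt_min hc.2 hcw.2⟩ ⟨max_lt hc'.1 hcw'.1, lt_min hc'.2 hcw'.2⟩
  · refine (hg.mono (strip_mono (le_max_left _ _) (min_le_left _ _))).mul fun ζ hζ => ?_
    have hζ' : ζ ∈ strip r ν (spiralArg r ν w) (spiralArg r ν w + 2 * Real.pi) :=
      strip_mono (le_max_right _ _) (min_le_right _ _) hζ
    exact (DifferentiableAt.comp (g := kernel) (f := fun ζ => ζ - w) ζ
      (differentiableAt_kernel (exp_sub_ne_one hζ'.1 hζ'.2)) (by fun_prop)).differentiableWithinAt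
  · intro ζ hζ ht
    have h1 := hM ζ (strip_mono (le_max_left _ _) (min_le_left _ _) hζ)
    have h2 : ‖kernel (ζ - w)‖ ≤ 2 := norm_kernel_le_two (by
      have := abs_sub_abs_le_abs_sub ζ.re w.re
      rw [sub_re]; linarith)
    rw [norm_mul, mul_right_comm]
    exact mul_le_mul h1 h2 (norm_nonneg _) ((norm_nonneg _).trans h1)

/-! ### The jump of the Cauchy-Heine integral -/

/-- The function `e^{u/2} / (e^u - 1) = 1 / (2 sinh (u/2))` has the same residue at `0` as the
kernel, but decays at both ends and has an elementary primitive. It serves as the model for the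
jump. -/
lemma norm_exp_half_mul_kernel_le {u : ℂ} (hu : 1 ≤ |u.re|) :
    ‖exp (u / 2) * kernel u‖ ≤ 2 * Real.exp (-(1 / 2) * |u.re|) := by
  have hre : (u / 2).re = u.re / 2 := by simp
  rw [norm_mul, norm_exp, hre]
  rcases le_abs.1 hu with h | h
  · have h1 : Real.exp u.re / 2 ≤ ‖exp u - 1‖ := by
      refine le_trans ?_ ((le_abs_self _).trans (abs_exp_re_sub_one_le u))
      have := Real.add_one_le_exp u.re
      linarith
    have h2 : ‖kernel u‖ ≤ (Real.exp u.re / 2)⁻¹ := by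
      rw [kernel, norm_inv]; exact inv_anti₀ (by positivity) h1
    refine (mul_le_mul_of_nonneg_left h2 (Real.exp_pos _).le).trans (le_of_eq ?_)
    rw [abs_of_pos (by linarith), inv_div, ← mul_div_assoc, mul_comm _ (2 : ℝ), mul_div_assoc,
      ← Real.exp_sub]
    ring_nf
  · rw [mul_comm]
    refine mul_le_mul (norm_kernel_le_two hu) (Real.exp_le_exp.2 ?_) (Real.exp_pos _).le two_pos.le
    rw [abs_of_neg (by linarith)]
    linarith

lemma integrable_exp_half_mul_kernel {r ν c : ℝ} {w : ℂ} (h : c - spiralArg r ν w ∈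
    Ioo 0 (2 * Real.pi)) : Integrable fun t =>
      (fun ζ => exp ((ζ - w) / 2) * kernel (ζ - w)) (contour r ν c t) * contourSpeed r ν t := by
  have hne : ∀ ζ ∈ strip r ν (spiralArg r ν w) (spiralArg r ν w + 2 * Real.pi),
      exp (ζ - w) - 1 ≠ 0 := fun ζ hζ => exp_sub_ne_one hζ.1 hζ.2
  have hcont : ContinuousOn (fun ζ => exp ((ζ - w) / 2) * kernel (ζ - w))
      (strip r ν (spiralArg r ν w) (spiralArg r ν w + 2 * Real.pi)) := by
    unfold kernel
    exact ContinuousOn.mul (by fun_prop) (ContinuousOn.inv₀ (by fun_prop) hne)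
  have hc : c ∈ Ioo (spiralArg r ν w) (spiralArg r ν w + 2 * Real.pi) :=
    ⟨by linarith [h.1], by linarith [h.2]⟩
  obtain ⟨c₁, h1, h1'⟩ := exists_between hc.1
  obtain ⟨c₂, h2, h2'⟩ := exists_between hc.2
  obtain ⟨M, -, hM⟩ := exists_decay_bound (α := 1 / 2) (M := 2 * Real.exp ((1 / 2) * |w.re|))
    (T := |w.re| + 1) hcont (fun ζ _ ht => by
      have h3 := abs_sub_abs_le_abs_sub ζ.re w.re
      refine (norm_exp_half_mul_kernel_le (by rw [sub_re]; linarith)).trans ?_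
      rw [mul_assoc, ← Real.exp_add, sub_re]
      refine mul_le_mul_of_nonneg_left (Real.exp_le_exp.2 ?_) two_pos.le
      linarith) h1 h2'
  refine integrable_contour (M := M) (α := 1 / 2) one_half_pos hcont hc fun t => ?_
  have := hM (contour r ν c t) (by rw [spiralArg_contour]; exact ⟨h1'.le, h2.le⟩)
  simpa [contour_re] using this

/-- The real part is `2 Im v / |v+1|²` and the imaginary part `(1 - |v|²) / |v+1|²`, so only points
of the unit circle could fall on the cut. -/
lemma cayley_mem_slitPlane {v : ℂ} (hv : normSq v = 1 → 0 < v.im) :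
    v + 1 ≠ 0 ∧ -I * ((v - 1) / (v + 1)) ∈ slitPlane := by
  have hne : v + 1 ≠ 0 := fun h => by
    have : v = -1 := eq_neg_of_add_eq_zero_left h
    have h1 := hv (by rw [this]; simp)
    rw [this] at h1; simp at h1
  refine ⟨hne, ?_⟩
  have hn : 0 < normSq (v + 1) := normSq_pos.2 hne
  have hre : (-I * ((v - 1) / (v + 1))).re = 2 * v.im / normSq (v + 1) := by
    simp [div_im]; field_simp; ring
  have him : (-I * ((v - 1) / (v + 1))).im = (1 - normSq v) / normSq (v + 1) := by
    simp [div_re, normSq_apply v]; field_simp; ring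
  rw [mem_slitPlane_iff, hre, him]
  by_cases h : normSq v = 1
  · exact Or.inl (div_pos (mul_pos two_pos (hv h)) hn)
  · exact Or.inr (div_ne_zero (sub_ne_zero.2 (Ne.symm h)) hn.ne')

lemma hasDerivAt_log_cayley {u : ℂ} (h1 : exp (u / 2) + 1 ≠ 0)
    (h2 : -I * ((exp (u / 2) - 1) / (exp (u / 2) + 1)) ∈ slitPlane) :
    HasDerivAt (fun u => log (-I * ((exp (u / 2) - 1) / (exp (u / 2) + 1))))
      (exp (u / 2) * kernel u) u := by
  have hv : HasDerivAt (fun u : ℂ => exp (u / 2)) (exp (u / 2) * (1 / 2)) u :=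
    ((hasDerivAt_id u).div_const 2).cexp
  have h := (((hv.sub_const 1).div (hv.add_const 1) h1).const_mul (-I)).clog h2
  have h0 := slitPlane_ne_zero h2
  have h3 : exp (u / 2) - 1 ≠ 0 := fun h => h0 (by simp [h])
  have h4 : exp u - 1 = (exp (u / 2) - 1) * (exp (u / 2) + 1) := by
    have : exp u = exp (u / 2) * exp (u / 2) := by rw [← exp_add]; ring_nf
    rw [this]; ring
  convert! h using 1
  rw [kernel, h4]
  have := I_ne_zero
  simp only [Pi.div_apply]
  field_simp
  ring

/-- With `v = e^{(ζ-w)/2}`, the primitive `log(-i (v-1)/(v+1))` goes from `log i` at `v = 0` to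
`log(-i)` at `v = ∞`. The path meets `|v| = 1` only at `Re ζ = Re w`, where `Im v > 0`, so the
principal branch is continuous along it. -/
lemma spiralIntegral_exp_half_mul_kernel {r ν c : ℝ} {w : ℂ}
    (h : c - spiralArg r ν w ∈ Ioo 0 (2 * Real.pi)) :
    spiralIntegral r ν c (fun ζ => exp ((ζ - w) / 2) * kernel (ζ - w)) = -(Real.pi * I) := by
  have hslit : ∀ t, exp ((contour r ν c t - w) / 2) + 1 ≠ 0 ∧
      -I * ((exp ((contour r ν c t - w) / 2) - 1) / (exp ((contour r ν c t - w) / 2) + 1))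
        ∈ slitPlane := fun t => cayley_mem_slitPlane fun hn => by
    have h0 : t = w.re := by
      rw [normSq_eq_norm_sq, norm_exp, pow_eq_one_iff_of_nonneg (Real.exp_pos _).le two_ne_zero,
        Real.exp_eq_one_iff] at hn
      simp [contour_re] at hn
      linarith
    have h1 : (contour r ν c t - w) / 2 = (((c - spiralArg r ν w) / 2 : ℝ) : ℂ) * I := by
      conv_lhs => rw [h0, ← contour_spiralArg r ν w, contour_re]
      simp only [contour_eq]; push_cast; ring
    rw [h1, exp_ofReal_mul_I_im]
    exact Real.sin_pos_of_pos_of_lt_pi (by linarith [h.1]) (by linarith [h.2])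
  have hre : ∀ t, ‖exp ((contour r ν c t - w) / 2)‖ = Real.exp ((t - w.re) / 2) := fun t => by
    rw [norm_exp]; simp [contour_re]
  have hcomp : ∀ {l : Filter ℝ} {z : ℂ}, z ∈ slitPlane →
      Tendsto (fun t => (exp ((contour r ν c t - w) / 2) - 1) /
        (exp ((contour r ν c t - w) / 2) + 1)) l (𝓝 (z / (-I))) →
      Tendsto (fun t => log (-I * ((exp ((contour r ν c t - w) / 2) - 1) /
        (exp ((contour r ν c t - w) / 2) + 1)))) l (𝓝 (log z)) := fun {l z} hz hl => by
    refine Tendsto.clog ?_ hz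
    convert hl.const_mul (-I) using 2
    field_simp
  rw [spiralIntegral, contour_tendsto_integral r ν c
    (Φ := fun ζ => log (-I * ((exp ((ζ - w) / 2) - 1) / (exp ((ζ - w) / 2) + 1))))
    (Φ' := fun ζ => exp ((ζ - w) / 2) * kernel (ζ - w)) (a := log I) (b := log (-I))]
  · rw [log_I, log_neg_I]; ring
  · exact fun t => (hasDerivAt_log_cayley (hslit t).1 (hslit t).2).comp_sub_const _ _
  · exact integrable_exp_half_mul_kernel h
  · refine hcomp (by simp [mem_slitPlane_iff]) ?_
    have h0 : Tendsto (fun t => exp ((contour r ν c t - w) / 2)) atBot (𝓝 0) := by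
      rw [tendsto_zero_iff_norm_tendsto_zero]
      simp only [hre]
      exact Real.tendsto_exp_atBot.comp
        ((tendsto_atBot_add_const_right _ (-w.re) tendsto_id).atBot_div_const two_pos)
    have := (h0.sub_const 1).div (h0.add_const 1) (by simp)
    convert this using 2
    · rfl
    · rw [div_neg, div_self I_ne_zero]
      norm_num
  · refine hcomp (by simp [mem_slitPlane_iff]) ?_
    have h0 : Tendsto (fun t => (exp ((contour r ν c t - w) / 2))⁻¹) atTop (𝓝 0) := by
      rw [tendsto_zero_iff_norm_tendsto_zero]
      simp only [norm_inv, hre]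
      exact tendsto_inv_atTop_zero.comp (Real.tendsto_exp_atTop.comp
        ((tendsto_atTop_add_const_right _ (-w.re) tendsto_id).atTop_div_const two_pos))
    have := (h0.const_sub 1).div (h0.const_add 1) (by simp)
    convert this using 2
    · rename_i t
      have h1 := exp_ne_zero ((contour r ν c t - w) / 2)
      have h2 := (hslit t).1
      rw [Pi.div_apply, div_eq_div_iff h2 (by
        intro h3
        apply h2
        have : exp ((contour r ν c t - w) / 2) + 1 = exp ((contour r ν c t - w) / 2) *
          (1 + (exp ((contour r ν c t - w) / 2))⁻¹) := by field_simp
        rw [this, h3, mul_zero])]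
      field_simp
    · simp

lemma spiralIntegral_add_two_pi (r ν c : ℝ) (F : ℂ → ℂ) :
    spiralIntegral r ν (c + 2 * Real.pi) F =
      spiralIntegral r ν c (fun ζ => F (ζ + 2 * Real.pi * I)) := by
  unfold spiralIntegral
  congr 1; ext t
  rw [contour_add]; push_cast; rfl

lemma exp_half_mul_kernel_add_two_pi (u : ℂ) :
    exp ((u + 2 * Real.pi * I) / 2) * kernel (u + 2 * Real.pi * I) =
      -(exp (u / 2) * kernel u) := by
  rw [kernel_add_two_pi_I, show (u + 2 * Real.pi * I) / 2 = u / 2 + Real.pi * I by ring, exp_add,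
    exp_pi_mul_I]
  ring

/-- Translation by `2πi` carries the path to the other side of `w` and changes the sign of
`e^{u/2}`. -/
lemma spiralIntegral_exp_half_mul_kernel_of_neg {r ν c : ℝ} {w : ℂ}
    (h : c - spiralArg r ν w ∈ Ioo (-(2 * Real.pi)) 0) :
    Integrable (fun t => (fun ζ => exp ((ζ - w) / 2) * kernel (ζ - w)) (contour r ν c t)
      * contourSpeed r ν t) ∧
    spiralIntegral r ν c (fun ζ => exp ((ζ - w) / 2) * kernel (ζ - w)) = Real.pi * I := by
  have h' : c + 2 * Real.pi - spiralArg r ν w ∈ Ioo 0 (2 * Real.pi) :=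
    ⟨by linarith [h.1], by linarith [h.2]⟩
  have e : ∀ t, exp ((contour r ν (c + 2 * Real.pi) t - w) / 2) *
      kernel (contour r ν (c + 2 * Real.pi) t - w) =
      -(exp ((contour r ν c t - w) / 2) * kernel (contour r ν c t - w)) := fun t => by
    rw [← exp_half_mul_kernel_add_two_pi, contour_add]; push_cast; ring_nf
  constructor
  · have := (integrable_exp_half_mul_kernel h').neg
    refine this.congr (Eventually.of_forall fun t => ?_)
    simp only [Pi.neg_apply, e]; ring
  · have := spiralIntegral_exp_half_mul_kernel h'
    unfold spiralIntegral at this ⊢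
    simp only [e, neg_mul, integral_neg] at this
    exact neg_injective this

/-- A residue computation without closed contours: subtracting `g(w) e^{(ζ-w)/2}` from `g` removes
the pole, so the remaining integral is the same on both sides of `w`, while the model term
contributes `πi g(w)` and `-πi g(w)`. -/
theorem spiralIntegral_mul_kernel_sub {r ν a b α M : ℝ} (hα : 0 < α) {g : ℂ → ℂ}
    (hab : b - a ≤ 2 * Real.pi) (hg : DifferentiableOn ℂ g (strip r ν a b))
    (hM : ∀ ζ ∈ strip r ν a b, ‖g ζ‖ ≤ M * Real.exp (-α * |ζ.re|)) {w : ℂ} {c c' : ℝ}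
    (hw : w ∈ strip r ν a b) (hc : c ∈ Ioo a (spiralArg r ν w))
    (hc' : c' ∈ Ioo (spiralArg r ν w) b) :
    spiralIntegral r ν c (fun ζ => g ζ * kernel (ζ - w)) -
      spiralIntegral r ν c' (fun ζ => g ζ * kernel (ζ - w)) = 2 * Real.pi * I * g w := by
  obtain ⟨hwa, hwb⟩ := hw
  have hw : w ∈ strip r ν a b := ⟨hwa, hwb⟩
  have hnhds := (isOpen_strip r ν a b).mem_nhds hw
  set h : ℂ → ℂ := fun ζ => g ζ - g w * exp ((ζ - w) / 2) with hh
  set E : ℂ → ℂ := fun ζ => exp (ζ - w) - 1 with hE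
  -- As quotients of divided differences, `F` extends `(g - g(w) e^{(ζ-w)/2}) · kernel`
  -- holomorphically through `ζ = w`.
  set F : ℂ → ℂ := fun ζ => dslope h w ζ * (dslope E w ζ)⁻¹ with hF
  have hhw : h w = 0 := by simp [hh]
  have hEw : E w = 0 := by simp [hE]
  have hdh : DifferentiableOn ℂ h (strip r ν a b) := hg.sub (by fun_prop)
  have hne : ∀ ζ ∈ strip r ν a b, ζ ≠ w → exp (ζ - w) - 1 ≠ 0 := fun ζ hζ hζw h0 =>
    hζw (eq_of_exp_sub_eq_one (r := r) (ν := ν)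
      (abs_lt.2 ⟨by linarith [hζ.1], by linarith [hζ.2]⟩) h0)
  have hEne : ∀ ζ ∈ strip r ν a b, dslope E w ζ ≠ 0 := by
    intro ζ hζ
    rcases eq_or_ne ζ w with rfl | hζw
    · have : HasDerivAt E (exp (ζ - ζ) * 1) ζ :=
        (((hasDerivAt_id ζ).sub_const ζ).cexp).sub_const 1
      rw [dslope_same, this.deriv]; simp
    · rw [dslope_of_ne _ hζw, slope_def_field, hEw, sub_zero]
      exact div_ne_zero (hne ζ hζ hζw) (sub_ne_zero.2 hζw)
  have hFeq : ∀ ζ, ζ ≠ w → F ζ =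
      g ζ * kernel (ζ - w) - g w * (exp ((ζ - w) / 2) * kernel (ζ - w)) := by
    intro ζ hζw
    have h1 := sub_ne_zero.2 hζw
    simp only [hF, dslope_of_ne _ hζw, slope_def_field, hEw, hhw, sub_zero]
    rw [inv_div, div_mul_div_comm, mul_comm (h ζ), mul_div_mul_left _ _ h1]
    simp only [hh, hE, kernel]; ring
  have hdF : DifferentiableOn ℂ F (strip r ν a b) :=
    ((differentiableOn_dslope hnhds).2 hdh).mul
      (((differentiableOn_dslope hnhds).2 (by fun_prop)).inv hEne)
  set α' := min α (1 / 2) with hα'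
  have hα'0 : 0 < α' := lt_min hα one_half_pos
  have hdecay : ∀ ζ ∈ strip r ν a b, |w.re| + 1 ≤ |ζ.re| → ‖F ζ‖ ≤
      (M * 2 + ‖g w‖ * (2 * Real.exp ((1 / 2) * |w.re|))) * Real.exp (-α' * |ζ.re|) := by
    intro ζ hζ ht
    have h3 := abs_sub_abs_le_abs_sub ζ.re w.re
    have hre : 1 ≤ |(ζ - w).re| := by rw [sub_re]; linarith
    rw [hFeq ζ (by rintro rfl; simp at ht; linarith)]
    refine (norm_sub_le _ _).trans ?_
    rw [add_mul, norm_mul, norm_mul]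
    refine add_le_add ?_ ?_
    · have h1 := (hM ζ hζ).trans (mul_le_mul_of_nonneg_left
        (exp_neg_mul_abs_le (min_le_left α (1 / 2)) ζ.re) ?_)
      · rw [mul_right_comm]
        exact mul_le_mul h1 (norm_kernel_le_two hre) (norm_nonneg _) ((norm_nonneg _).trans h1)
      · exact nonneg_of_mul_nonneg_left ((norm_nonneg _).trans (hM ζ hζ)) (Real.exp_pos _)
    · rw [mul_assoc, mul_assoc]
      refine mul_le_mul_of_nonneg_left ?_ (norm_nonneg _)
      refine (norm_exp_half_mul_kernel_le hre).trans (mul_le_mul_of_nonneg_left ?_ two_pos.le)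
      refine le_trans ?_ (mul_le_mul_of_nonneg_left
        (exp_neg_mul_abs_le (min_le_right α (1 / 2)) ζ.re) (Real.exp_pos _).le)
      rw [← Real.exp_add, sub_re]
      refine Real.exp_le_exp.2 ?_
      linarith
  have hcI : c ∈ Ioo a b := ⟨hc.1, hc.2.trans hwb⟩
  have hcI' : c' ∈ Ioo a b := ⟨hwa.trans hc'.1, hc'.2⟩
  have key := spiralIntegral_eq_of_decay hα'0 hdF hdecay hcI hcI'
  obtain ⟨hi, hv⟩ := spiralIntegral_exp_half_mul_kernel_of_neg (r := r) (ν := ν) (c := c) (w := w)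
    ⟨by linarith [hc.1], by linarith [hc.2]⟩
  have hm' : c' - spiralArg r ν w ∈ Ioo 0 (2 * Real.pi) :=
    ⟨by linarith [hc'.1], by linarith [hc'.2]⟩
  have hi' := integrable_exp_half_mul_kernel hm'
  have hv' := spiralIntegral_exp_half_mul_kernel hm'
  have hsplit : ∀ x ∈ Ioo a b, x ≠ spiralArg r ν w →
      Integrable (fun t => (fun ζ => exp ((ζ - w) / 2) * kernel (ζ - w)) (contour r ν x t)
        * contourSpeed r ν t) →
      spiralIntegral r ν x (fun ζ => g ζ * kernel (ζ - w)) = spiralIntegral r ν x F +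
        g w * spiralIntegral r ν x (fun ζ => exp ((ζ - w) / 2) * kernel (ζ - w)) := by
    intro x hx hxw hix
    obtain ⟨x₁, h1, h1'⟩ := exists_between hx.1
    obtain ⟨x₂, h2, h2'⟩ := exists_between hx.2
    obtain ⟨M', -, hM'⟩ := exists_decay_bound hdF.continuousOn hdecay h1 h2'
    have hiF := integrable_contour (M := M') hα'0 hdF.continuousOn hx fun t => by
      have := hM' (contour r ν x t) (by rw [spiralArg_contour]; exact ⟨h1'.le, h2.le⟩)
      simpa [contour_re] using this
    unfold spiralIntegral
    rw [← integral_const_mul, ← integral_add hiF (hix.const_mul _)]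
    congr 1; ext t
    rw [hFeq _ (fun h0 => hxw (by rw [← h0, spiralArg_contour]))]
    ring
  rw [hsplit c hcI hc.2.ne hi, hsplit c' hcI' hc'.1.ne' hi', key, hv, hv']
  ring

/-! ### Holomorphic functions on normed spaces and integrals with parameters -/

/-- The one-variable Cauchy estimate on each complex line through `p`, with discs of radius `R/4`.
-/
lemma norm_fderiv_le_of_norm_le {E : Type*} [NormedAddCommGroup E] [NormedSpace ℂ E] {f : E → ℂ}
    {p₀ p : E} {R B : ℝ} (hR : 0 < R) (hf : DifferentiableOn ℂ f (Metric.ball p₀ R))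
    (hB : ∀ p ∈ Metric.ball p₀ R, ‖f p‖ ≤ B) (hp : p ∈ Metric.ball p₀ (R / 2)) :
    ‖fderiv ℂ f p‖ ≤ 4 * B / R := by
  have hsub : ∀ q, ‖q - p‖ ≤ R / 4 → q ∈ Metric.ball p₀ R := fun q hq => by
    rw [mem_ball_iff_norm] at hp ⊢
    have := norm_sub_le_norm_sub_add_norm_sub q p p₀
    linarith
  have hB0 : 0 ≤ B := (norm_nonneg _).trans (hB p (hsub p (by simp; positivity)))
  refine ContinuousLinearMap.opNorm_le_bound _ (by positivity) fun v => ?_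
  rcases eq_or_ne v 0 with rfl | hv
  · simp
  have hv' := norm_pos_iff.2 hv
  have hmem : ∀ z : ℂ, z ∈ Metric.closedBall (0 : ℂ) (R / 4 / ‖v‖) →
      p + z • v ∈ Metric.ball p₀ R := fun z hz => hsub _ (by
    rw [mem_closedBall_zero_iff, le_div_iff₀ hv'] at hz
    simpa [norm_smul] using hz)
  have hd : ∀ z : ℂ, HasDerivAt (fun z : ℂ => p + z • v) v z := fun z => by
    simpa using ((hasDerivAt_id z).smul_const v).const_add p
  have h1 : DifferentiableOn ℂ (fun z : ℂ => f (p + z • v))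
      (Metric.closedBall 0 (R / 4 / ‖v‖)) := by
    intro z hz
    exact ((hf.differentiableAt (Metric.isOpen_ball.mem_nhds (hmem z hz))).comp z
      (hd z).differentiableAt).differentiableWithinAt
  have h2 := norm_deriv_le_of_forall_mem_sphere_norm_le (f := fun z : ℂ => f (p + z • v)) (c := 0)
    (R := R / 4 / ‖v‖) (C := B) (by positivity) (h1.diffContOnCl_ball subset_rfl)
    (fun z hz => hB _ (hmem z (Metric.sphere_subset_closedBall hz)))
  have h3 : HasDerivAt (fun z : ℂ => f (p + z • v)) (fderiv ℂ f p v) 0 := by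
    have h4 : HasFDerivAt f (fderiv ℂ f p) (p + (0 : ℂ) • v) := by
      rw [zero_smul, add_zero]
      exact (hf.differentiableAt (Metric.isOpen_ball.mem_nhds
        (hsub p (by simp; positivity)))).hasFDerivAt
    exact h4.comp_hasDerivAt (0 : ℂ) (hd 0)
  rw [h3.deriv] at h2
  refine h2.trans (le_of_eq ?_)
  field_simp

lemma differentiableOn_of_geometric_bound {E : Type*} [NormedAddCommGroup E] [NormedSpace ℂ E]
    {U : Set E} (hU : IsOpen U) {f : ℕ → E → ℂ} {F : E → ℂ} {C q : ℝ} (hq0 : 0 ≤ q) (hq : q < 1)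
    (hf : ∀ n, DifferentiableOn ℂ (f n) U) (hb : ∀ n, ∀ p ∈ U, ‖f n p‖ ≤ C * q ^ n)
    (hF : ∀ p ∈ U, HasSum (fun n => f n p) (F p)) : DifferentiableOn ℂ F U := by
  intro p hp
  obtain ⟨R, hR, hRU⟩ := Metric.isOpen_iff.1 hU p hp
  have hp2 : p ∈ Metric.ball p (R / 2) := Metric.mem_ball_self (by positivity)
  have h2 : Metric.ball p (R / 2) ⊆ U := (Metric.ball_subset_ball (by linarith)).trans hRU
  have key := hasFDerivAt_tsum_of_isPreconnected (𝕜 := ℂ) (u := fun n => 4 * (C * q ^ n) / R)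
    (((summable_geometric_of_lt_one hq0 hq).mul_left C |>.mul_left 4).div_const R)
    Metric.isOpen_ball (Metric.isPreconnected_ball (x := p) (r := R / 2))
    (fun n x hx => ((hf n).differentiableAt (hU.mem_nhds (h2 hx))).hasFDerivAt)
    (fun n x hx => norm_fderiv_le_of_norm_le hR ((hf n).mono hRU)
      (fun y hy => hb n y (hRU hy)) hx) hp2 (hF p hp).summable hp2
  refine (key.differentiableAt.congr_of_eventuallyEq ?_).differentiableWithinAt
  filter_upwards [hU.mem_nhds hp] with x hx
  exact (hF x hx).tsum_eq.symm

lemma differentiableAt_integral_of_bounded {X : Type*} [MeasurableSpace X] {m : Measure X}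
    {f : ℂ × ℂ → X → ℂ} {p₀ : ℂ × ℂ} {R : ℝ} (hR : 0 < R) {bound : X → ℝ}
    (hf : ∀ t, DifferentiableOn ℂ (fun p => f p t) (Metric.ball p₀ R))
    (hmeas : ∀ p ∈ Metric.ball p₀ R, AEStronglyMeasurable (f p) m)
    (hb : ∀ p ∈ Metric.ball p₀ R, ∀ t, ‖f p t‖ ≤ bound t) (hi : Integrable bound m) :
    DifferentiableAt ℂ (fun p => ∫ t, f p t ∂m) p₀ := by
  have h0 : p₀ ∈ Metric.ball p₀ R := Metric.mem_ball_self hR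
  have hsub : Metric.ball p₀ (R / 2) ⊆ Metric.ball p₀ R := Metric.ball_subset_ball (by linarith)
  -- Differentiation under the integral needs the derivative to be measurable in `t`: each
  -- directional derivative is a limit of measurable difference quotients, and two directions
  -- determine the differential.
  have hdir : ∀ v : ℂ × ℂ, AEStronglyMeasurable (fun t => fderiv ℂ (fun p => f p t) p₀ v) m := by
    intro v
    have hz : Tendsto (fun n : ℕ => R / ((‖v‖ + 1) * ((n : ℝ) + 1))) atTop (𝓝 0) :=
      tendsto_const_nhds.div_atTop
        ((tendsto_natCast_atTop_atTop.atTop_add tendsto_const_nhds).const_mul_atTop (by positivity))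
    have hmem : ∀ n : ℕ, p₀ + ((R / ((‖v‖ + 1) * ((n : ℝ) + 1)) : ℝ) : ℂ) • v ∈
        Metric.ball p₀ R := fun n => by
      rw [mem_ball_iff_norm, add_sub_cancel_left, norm_smul, norm_real, Real.norm_eq_abs,
        abs_of_pos (by positivity), div_mul_eq_mul_div, div_lt_iff₀ (by positivity)]
      refine mul_lt_mul_of_pos_left ?_ hR
      nlinarith [norm_nonneg v, (Nat.cast_nonneg n : (0 : ℝ) ≤ n), mul_nonneg (norm_nonneg v)
        (Nat.cast_nonneg n : (0 : ℝ) ≤ n)]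
    refine aestronglyMeasurable_of_tendsto_ae atTop (f := fun (n : ℕ) t =>
      ((R / ((‖v‖ + 1) * ((n : ℝ) + 1)) : ℝ) : ℂ)⁻¹ •
        (f (p₀ + ((R / ((‖v‖ + 1) * ((n : ℝ) + 1)) : ℝ) : ℂ) • v) t - f p₀ t))
      (fun n => ((hmeas _ (hmem n)).sub (hmeas _ h0)).const_smul
        ((R / ((‖v‖ + 1) * ((n : ℝ) + 1)) : ℝ) : ℂ)⁻¹)
      (Eventually.of_forall fun t => ?_)
    have hd := ((hf t).differentiableAt (Metric.isOpen_ball.mem_nhds h0)).hasFDerivAt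
    have hl := (hasDerivAt_iff_tendsto_slope_zero).1
      (HasFDerivAt.comp_hasDerivAt (f := fun z : ℂ => p₀ + z • v) (0 : ℂ)
        (l := fun p => f p t) (l' := fderiv ℂ (fun p => f p t) p₀) (by simpa using hd)
        (by simpa using ((hasDerivAt_id (0 : ℂ)).smul_const v).const_add p₀))
    have hz' : Tendsto (fun n : ℕ => ((R / ((‖v‖ + 1) * ((n : ℝ) + 1)) : ℝ) : ℂ)) atTop
        (𝓝[≠] 0) := by
      refine tendsto_nhdsWithin_iff.2 ⟨?_, Eventually.of_forall fun n => ?_⟩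
      · exact (continuous_ofReal.tendsto' 0 0 ofReal_zero).comp hz
      · have : R / ((‖v‖ + 1) * ((n : ℝ) + 1)) ≠ 0 := by positivity
        exact ofReal_ne_zero.2 this
    have hlim := hl.comp hz'
    simp only [zero_add, zero_smul, add_zero, Function.comp_def] at hlim
    exact hlim
  have hF' : AEStronglyMeasurable (fun t => fderiv ℂ (fun p => f p t) p₀) m := by
    have : (fun t => fderiv ℂ (fun p => f p t) p₀) = fun t =>
        (fderiv ℂ (fun p => f p t) p₀ (1, 0)) • ContinuousLinearMap.fst ℂ ℂ ℂ +
          (fderiv ℂ (fun p => f p t) p₀ (0, 1)) • ContinuousLinearMap.snd ℂ ℂ ℂ := by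
      ext t <;> simp
    rw [this]
    exact ((hdir (1, 0)).smul aestronglyMeasurable_const).add
      ((hdir (0, 1)).smul aestronglyMeasurable_const)
  exact (hasFDerivAt_integral_of_dominated_of_fderiv_le (𝕜 := ℂ)
    (F' := fun p t => fderiv ℂ (fun p => f p t) p) (bound := fun t => 4 * bound t / R)
    (Metric.ball_mem_nhds p₀ (half_pos hR))
    (by filter_upwards [Metric.ball_mem_nhds p₀ hR] with p hp using hmeas p hp)
    (hi.mono' (hmeas p₀ h0) (Eventually.of_forall (hb p₀ h0))) hF'
    (Eventually.of_forall fun t p hp =>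
      norm_fderiv_le_of_norm_le hR (hf t) (fun q hq => hb q hq t) hp)
    ((hi.const_mul 4).div_const R)
    (Eventually.of_forall fun t p hp =>
      ((hf t).differentiableAt (Metric.isOpen_ball.mem_nhds (hsub hp))).hasFDerivAt)
    ).differentiableAt

/-! ### The Cauchy-Heine transform of a function on a spiral strip -/

/-- The function `g` is holomorphic and exponentially decaying on the strip of half-width `β`
around the path of argument `c`. -/
structure IsDecaying (r ν β c α M : ℝ) (g : ℂ → ℂ) : Prop where
  differentiableOn : DifferentiableOn ℂ g (strip r ν (c - β) (c + β))
  norm_le : ∀ ζ ∈ strip r ν (c - β) (c + β), ‖g ζ‖ ≤ M * Real.exp (-α * |ζ.re|)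

lemma IsDecaying.nonneg {r ν β c α M : ℝ} (hβ : 0 < β) {g : ℂ → ℂ}
    (h : IsDecaying r ν β c α M g) : 0 ≤ M :=
  nonneg_of_mul_nonneg_left ((norm_nonneg _).trans (h.norm_le (contour r ν c 0)
    (contour_mem_strip 0 ⟨by linarith, by linarith⟩))) (Real.exp_pos _)

/-- The argument of a path that stays in the strip of half-width `β` around `c`, and between the
points of arguments `s` and `s + 2π`. -/
def transversal (β c s : ℝ) : ℝ := c + β * (s - c + Real.pi) / (Real.pi + β)

/-- The map `s ↦ transversal β c s` is affine; it sends the ends `c - β - 2π` and `c + β` to `c - β`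
and `c + β`, that is, to `s + 2π` and `s` respectively. -/
lemma transversal_mem {β c s : ℝ} (hβ : 0 < β)
    (hs : s ∈ Ioo (c - β - 2 * Real.pi) (c + β)) :
    transversal β c s ∈ Ioo (c - β) (c + β) ∩ Ioo s (s + 2 * Real.pi) := by
  have hπ := Real.pi_pos
  have hpos : 0 < Real.pi + β := by linarith
  obtain ⟨h1, h2⟩ := hs
  have e : β * (s - c + Real.pi) / (Real.pi + β) * (Real.pi + β) = β * (s - c + Real.pi) := by
    field_simp
  unfold transversal
  set x := β * (s - c + Real.pi) / (Real.pi + β)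
  refine ⟨⟨?_, ?_⟩, ?_, ?_⟩ <;> by_contra! h <;> nlinarith

/-- The Cauchy-Heine transform of a function `g` on the strip of half-width `β` around `c`. -/
def cauchyHeine (r ν β c : ℝ) (g : ℂ → ℂ) (w : ℂ) : ℂ :=
  (2 * Real.pi * I)⁻¹ * spiralIntegral r ν (transversal β c (spiralArg r ν w))
    (fun ζ => g ζ * kernel (ζ - w))

lemma mem_strip_of_mem {r ν β c c' : ℝ} {w : ℂ} (h : c' ∈ Ioo (c - β) (c + β))
    (hw : c' ∈ Ioo (spiralArg r ν w) (spiralArg r ν w + 2 * Real.pi)) :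
    w ∈ strip r ν (c - β - 2 * Real.pi) (c + β) :=
  ⟨by linarith [h.1, hw.2], by linarith [h.2, hw.1]⟩

lemma cauchyHeine_eq {r ν β c c' α M : ℝ} (hβ : 0 < β) (hα : 0 < α) {g : ℂ → ℂ} {w : ℂ}
    (hg : IsDecaying r ν β c α M g) (h : c' ∈ Ioo (c - β) (c + β))
    (hw : c' ∈ Ioo (spiralArg r ν w) (spiralArg r ν w + 2 * Real.pi)) :
    cauchyHeine r ν β c g w =
      (2 * Real.pi * I)⁻¹ * spiralIntegral r ν c' (fun ζ => g ζ * kernel (ζ - w)) := by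
  have h' := transversal_mem hβ (mem_strip_of_mem h hw)
  rw [cauchyHeine, spiralIntegral_mul_kernel_eq hα hg.differentiableOn hg.norm_le h'.1 h h'.2 hw]

lemma IsDecaying.integrable_mul_kernel {r ν β c c' α M : ℝ} (hα : 0 < α)
    {g : ℂ → ℂ} {w : ℂ} (hβ : 0 < β)
    (hg : IsDecaying r ν β c α M g) (h : c' ∈ Ioo (c - β) (c + β))
    (hw : c' ∈ Ioo (spiralArg r ν w) (spiralArg r ν w + 2 * Real.pi)) :
    Integrable fun t =>
      (fun ζ => g ζ * kernel (ζ - w)) (contour r ν c' t) * contourSpeed r ν t := by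
  obtain ⟨η, hη, hη'⟩ := exists_between (lt_min (sub_pos.2 hw.1) (sub_pos.2 hw.2))
  rw [lt_min_iff] at hη'
  obtain ⟨C, hC0, hC⟩ := exists_norm_kernel_le r ν hη
  have hM := hg.nonneg hβ
  refine integrable_contour (F := fun ζ => g ζ * kernel (ζ - w)) (a := max (c - β) (spiralArg r ν w))
    (b := min (c + β) (spiralArg r ν w + 2 * Real.pi)) (M := M * C) hα ?_
    ⟨max_lt h.1 hw.1, lt_min h.2 hw.2⟩ fun t => ?_
  · refine (hg.differentiableOn.continuousOn.mono
      (strip_mono (le_max_left _ _) (min_le_left _ _))).mul ?_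
    unfold kernel
    refine ContinuousOn.inv₀ (by fun_prop) fun ζ hζ => ?_
    have hζ' : ζ ∈ strip r ν (spiralArg r ν w) (spiralArg r ν w + 2 * Real.pi) :=
      strip_mono (le_max_right _ _) (min_le_right _ _) hζ
    exact exp_sub_ne_one hζ'.1 hζ'.2
  · have h1 := hg.norm_le _ (contour_mem_strip t h)
    rw [contour_re] at h1
    rw [norm_mul, mul_right_comm]
    refine mul_le_mul h1 (hC _ _ ?_ ?_) (norm_nonneg _) ((norm_nonneg _).trans h1) <;>
    · rw [spiralArg_contour]; linarith

lemma cauchyHeine_sub {r ν β c α M M' : ℝ} (hβ : 0 < β) (hα : 0 < α) {g g' : ℂ → ℂ} {w : ℂ}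
    (hg : IsDecaying r ν β c α M g) (hg' : IsDecaying r ν β c α M' g')
    (hw : w ∈ strip r ν (c - β - 2 * Real.pi) (c + β)) :
    cauchyHeine r ν β c (fun ζ => g ζ - g' ζ) w =
      cauchyHeine r ν β c g w - cauchyHeine r ν β c g' w := by
  have h := transversal_mem hβ hw
  simp only [cauchyHeine, spiralIntegral]
  rw [← mul_sub, ← integral_sub (hg.integrable_mul_kernel hα hβ h.1 h.2)
    (hg'.integrable_mul_kernel hα hβ h.1 h.2)]
  congr 2; ext t; ring

/-- By periodicity both values are integrals of the same integrand, along a path below `w` for `w -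
2πi` and along a path above `w` for `w`. -/
theorem cauchyHeine_sub_two_pi_I {r ν β c α M : ℝ} (hβ : 0 < β) (hβπ : β ≤ Real.pi)
    (hα : 0 < α) {g : ℂ → ℂ} {w : ℂ} (hg : IsDecaying r ν β c α M g)
    (hw : w ∈ strip r ν (c - β) (c + β)) :
    cauchyHeine r ν β c g (w - 2 * Real.pi * I) - cauchyHeine r ν β c g w = g w := by
  obtain ⟨c₁, h1, h1'⟩ := exists_between hw.1
  obtain ⟨c₂, h2, h2'⟩ := exists_between hw.2
  have hwc : c - β < spiralArg r ν w ∧ spiralArg r ν w < c + β := hw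
  have hs : spiralArg r ν (w - 2 * Real.pi * I) = spiralArg r ν w - 2 * Real.pi := by
    have := spiralArg_add_mul_I r ν w (-(2 * Real.pi))
    push_cast at this
    rw [sub_eq_add_neg, ← neg_mul, this]; ring
  rw [cauchyHeine_eq hβ hα hg (c' := c₂) ⟨by linarith, h2'⟩ ⟨h2, by linarith⟩,
    cauchyHeine_eq hβ hα hg (c' := c₁) ⟨h1, by linarith⟩
      ⟨by rw [hs]; linarith, by rw [hs]; linarith⟩, ← mul_sub]
  have e : (fun ζ => g ζ * kernel (ζ - (w - 2 * Real.pi * I))) =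
      fun ζ => g ζ * kernel (ζ - w) := by
    ext ζ
    rw [← kernel_add_two_pi_I (ζ - w)]; ring_nf
  rw [e, spiralIntegral_mul_kernel_sub hα (by linarith) hg.differentiableOn hg.norm_le hw
    ⟨h1, h1'⟩ ⟨h2, h2'⟩, ← mul_assoc, inv_mul_cancel₀, one_mul]
  exact two_pi_I_ne_zero

lemma cauchyHeine_add_two_pi {r ν β c : ℝ} (hβ : 0 < β) {g g' : ℂ → ℂ} {w : ℂ}
    (hgg' : ∀ ζ ∈ strip r ν (c - β) (c + β), g' (ζ + 2 * Real.pi * I) = g ζ)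
    (hw : w ∈ strip r ν (c - β - 2 * Real.pi) (c + β)) :
    cauchyHeine r ν β (c + 2 * Real.pi) g' (w + 2 * Real.pi * I) = cauchyHeine r ν β c g w := by
  have h := transversal_mem hβ hw
  have hs : spiralArg r ν (w + 2 * Real.pi * I) = spiralArg r ν w + 2 * Real.pi := by
    have := spiralArg_add_mul_I r ν w (2 * Real.pi)
    push_cast at this; exact this
  have ht : transversal β (c + 2 * Real.pi) (spiralArg r ν w + 2 * Real.pi) =
      transversal β c (spiralArg r ν w) + 2 * Real.pi := by
    simp only [transversal]; ring
  rw [cauchyHeine, cauchyHeine, hs, ht, spiralIntegral_add_two_pi]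
  unfold spiralIntegral
  congr 2; ext t
  simp only
  rw [hgg' _ (contour_mem_strip t h.1), add_sub_add_right_eq_sub]

/-- Near the edges every admissible path comes close to a pole. For arguments of `w` in `[c - 2π,
c]` some path stays at distance `β/2`; elsewhere the jump relation brings `w` back there by `±2πi`,
at the cost of one value of `g`. -/
theorem exists_norm_cauchyHeine_le (r ν : ℝ) {β α : ℝ} (hβ : 0 < β) (hβπ : β ≤ Real.pi)
    (hα : 0 < α) : ∃ C, 0 ≤ C ∧ ∀ (c M : ℝ) (g : ℂ → ℂ) (w : ℂ), IsDecaying r ν β c α M g →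
      w ∈ strip r ν (c - β - 2 * Real.pi) (c + β) → ‖cauchyHeine r ν β c g w‖ ≤ C * M := by
  have hπ := Real.pi_pos
  obtain ⟨K, hK0, hK⟩ := exists_norm_kernel_le r ν (half_pos hβ)
  set J := (∫ t : ℝ, Real.exp (-α * |t|)) * (1 + |ν|) with hJ
  have hJ0 : 0 ≤ J := mul_nonneg (integral_nonneg fun t => (Real.exp_pos _).le) (by positivity)
  have path : ∀ (c M c' : ℝ) (g : ℂ → ℂ) (w : ℂ), IsDecaying r ν β c α M g →
      c' ∈ Ioo (c - β) (c + β) → spiralArg r ν w + β / 2 ≤ c' →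
      c' + β / 2 ≤ spiralArg r ν w + 2 * Real.pi →
      ‖cauchyHeine r ν β c g w‖ ≤ ‖(2 * Real.pi * I : ℂ)⁻¹‖ * (K * J) * M := by
    intro c M c' g w hg hc' h1 h2
    rw [cauchyHeine_eq hβ hα hg hc' ⟨by linarith, by linarith⟩, norm_mul,
      mul_assoc ‖(2 * Real.pi * I : ℂ)⁻¹‖]
    refine mul_le_mul_of_nonneg_left ?_ (norm_nonneg _)
    rw [show K * J * M = (M * K) * J by ring, hJ]
    refine norm_spiralIntegral_le (F := fun ζ => g ζ * kernel (ζ - w)) hα fun t => ?_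
    have h3 := hg.norm_le _ (contour_mem_strip t hc')
    rw [contour_re] at h3
    rw [norm_mul, mul_right_comm]
    exact mul_le_mul h3 (hK _ _ (by rw [spiralArg_contour]; exact h1)
      (by rw [spiralArg_contour]; exact h2)) (norm_nonneg _) ((norm_nonneg _).trans h3)
  have base : ∀ (c M : ℝ) (g : ℂ → ℂ) (w : ℂ), IsDecaying r ν β c α M g →
      c - 2 * Real.pi ≤ spiralArg r ν w → spiralArg r ν w ≤ c →
      ‖cauchyHeine r ν β c g w‖ ≤ ‖(2 * Real.pi * I : ℂ)⁻¹‖ * (K * J) * M := by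
    intro c M g w hg h1 h2
    -- The path is shifted away from the nearer pole: upwards from `w`, or downwards from `w + 2πi`.
    rcases le_total (c - Real.pi) (spiralArg r ν w) with h | h
    · exact path c M (c + β / 2) g w hg ⟨by linarith, by linarith⟩ (by linarith) (by linarith)
    · exact path c M (c - β / 2) g w hg ⟨by linarith, by linarith⟩ (by linarith) (by linarith)
  have hgM : ∀ (c M : ℝ) (g : ℂ → ℂ) (w : ℂ), IsDecaying r ν β c α M g →
      w ∈ strip r ν (c - β) (c + β) → ‖g w‖ ≤ M := fun c M g w hg hw =>
    (hg.norm_le w hw).trans (mul_le_of_le_one_right (hg.nonneg hβ) (Real.exp_le_one_iff.2 (by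
      nlinarith [abs_nonneg w.re])))
  refine ⟨‖(2 * Real.pi * I : ℂ)⁻¹‖ * (K * J) + 1, by positivity, fun c M g w hg hw => ?_⟩
  have hM := hg.nonneg hβ
  rw [add_mul, one_mul]
  obtain ⟨hw1, hw2⟩ := mem_strip.1 hw
  rcases le_total (spiralArg r ν w) c with h | h
  · rcases le_total (c - 2 * Real.pi) (spiralArg r ν w) with h' | h'
    · exact (base c M g w hg h' h).trans (by linarith)
    · have hs : spiralArg r ν (w + 2 * Real.pi * I) = spiralArg r ν w + 2 * Real.pi := by
        have := spiralArg_add_mul_I r ν w (2 * Real.pi)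
        push_cast at this; exact this
      have hmem : w + 2 * Real.pi * I ∈ strip r ν (c - β) (c + β) := by
        rw [mem_strip, hs]; constructor <;> linarith
      have key := cauchyHeine_sub_two_pi_I hβ hβπ hα hg hmem
      rw [add_sub_cancel_right, sub_eq_iff_eq_add] at key
      rw [key, add_comm]
      exact (norm_add_le _ _).trans (add_le_add (base c M g _ hg (by rw [hs]; linarith)
        (by rw [hs]; linarith)) (hgM c M g _ hg hmem))
  · have hs : spiralArg r ν (w - 2 * Real.pi * I) = spiralArg r ν w - 2 * Real.pi := by
      have := spiralArg_add_mul_I r ν w (-(2 * Real.pi))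
      push_cast at this
      rw [sub_eq_add_neg, ← neg_mul, this]; ring
    have hmem : w ∈ strip r ν (c - β) (c + β) := ⟨by linarith, hw2⟩
    have key := cauchyHeine_sub_two_pi_I hβ hβπ hα hg hmem
    rw [sub_eq_iff_eq_add, ← sub_eq_iff_eq_add'] at key
    rw [← key]
    exact (norm_sub_le _ _).trans (add_le_add (base c M g _ hg (by rw [hs]; linarith)
      (by rw [hs]; linarith)) (hgM c M g _ hg hmem))

theorem differentiableOn_cauchyHeine {r ν β c α M ρ : ℝ} (hβ : 0 < β) (hα : 0 < α)
    {G : ℂ × ℂ → ℂ}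
    (hG : DifferentiableOn ℂ G (strip r ν (c - β) (c + β) ×ˢ Metric.ball 0 ρ))
    (hM : ∀ p ∈ strip r ν (c - β) (c + β) ×ˢ Metric.ball (0 : ℂ) ρ,
      ‖G p‖ ≤ M * Real.exp (-α * |p.1.re|)) :
    DifferentiableOn ℂ (fun p : ℂ × ℂ => cauchyHeine r ν β c (fun ζ => G (ζ, p.2)) p.1)
      (strip r ν (c - β - 2 * Real.pi) (c + β) ×ˢ Metric.ball 0 ρ) := by
  have hdec : ∀ y ∈ Metric.ball (0 : ℂ) ρ, IsDecaying r ν β c α M fun ζ => G (ζ, y) :=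
    fun y hy => ⟨hG.comp (by fun_prop) fun ζ hζ => ⟨hζ, hy⟩, fun ζ hζ => hM (ζ, y) ⟨hζ, hy⟩⟩
  rintro p₀ ⟨hw, hy⟩
  have h := transversal_mem hβ hw
  set c' := transversal β c (spiralArg r ν p₀.1) with hc'
  obtain ⟨η, hη, hη'⟩ := exists_between (lt_min (sub_pos.2 h.2.1) (sub_pos.2 h.2.2))
  rw [lt_min_iff] at hη'
  obtain ⟨C, hC0, hC⟩ := exists_norm_kernel_le r ν hη
  have hopen : IsOpen (strip r ν (c' + η - 2 * Real.pi) (c' - η) ×ˢ Metric.ball (0 : ℂ) ρ) :=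
    (isOpen_strip _ _ _ _).prod Metric.isOpen_ball
  -- The path chosen for `p₀` serves for all nearby points, so the domain of integration is fixed.
  obtain ⟨R, hR, hRU⟩ := Metric.isOpen_iff.1 hopen p₀ ⟨⟨by linarith, by linarith⟩, hy⟩
  have hw' : ∀ p ∈ Metric.ball p₀ R,
      c' ∈ Ioo (spiralArg r ν p.1) (spiralArg r ν p.1 + 2 * Real.pi) := fun p hp => by
    have := mem_strip.1 (hRU hp).1
    exact ⟨by linarith, by linarith⟩
  have key : DifferentiableAt ℂ (fun p : ℂ × ℂ => ∫ t : ℝ, (fun ζ => G (ζ, p.2) * kernel (ζ - p.1))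
      (contour r ν c' t) * contourSpeed r ν t) p₀ := by
    refine differentiableAt_integral_of_bounded hR
      (bound := fun t => M * C * Real.exp (-α * |t|) * (1 + |ν|)) (fun t p hp => ?_)
      (fun p hp => ((hdec p.2 (hRU hp).2).integrable_mul_kernel hα hβ h.1
        (hw' p hp)).aestronglyMeasurable) (fun p hp t => ?_)
      (((integrable_exp_neg_mul_abs hα).const_mul _).mul_const _)
    · have hmem : (contour r ν c' t, p.2) ∈ strip r ν (c - β) (c + β) ×ˢ Metric.ball (0 : ℂ) ρ :=
        ⟨contour_mem_strip t h.1, (hRU hp).2⟩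
      have h1 : DifferentiableAt ℂ (fun p : ℂ × ℂ => G (contour r ν c' t, p.2)) p :=
        DifferentiableAt.comp (g := G) (f := fun p : ℂ × ℂ => (contour r ν c' t, p.2)) p
          (hG.differentiableAt (((isOpen_strip _ _ _ _).prod Metric.isOpen_ball).mem_nhds hmem))
          (by fun_prop)
      have h2 : DifferentiableAt ℂ (fun p : ℂ × ℂ => kernel (contour r ν c' t - p.1)) p :=
        DifferentiableAt.comp (g := kernel) (f := fun p : ℂ × ℂ => contour r ν c' t - p.1) p
          (differentiableAt_kernel (exp_sub_ne_one (r := r) (ν := ν)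
            (by rw [spiralArg_contour]; exact (hw' p hp).1)
            (by rw [spiralArg_contour]; exact (hw' p hp).2))) (by fun_prop)
      exact ((h1.mul h2).mul_const _).differentiableWithinAt
    · have h1 := hM (contour r ν c' t, p.2) ⟨contour_mem_strip t h.1, (hRU hp).2⟩
      have h3 := mem_strip.1 (hRU hp).1
      have h2 := hC (contour r ν c' t) p.1 (by rw [spiralArg_contour]; linarith)
        (by rw [spiralArg_contour]; linarith)
      rw [norm_mul, norm_mul, mul_right_comm M]
      have h0 := (norm_nonneg _).trans h1
      exact mul_le_mul (mul_le_mul h1 h2 (norm_nonneg _) h0) (norm_contourSpeed_le r ν t)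
        (norm_nonneg _) (mul_nonneg h0 hC0)
  refine ((key.const_mul ((2 * Real.pi * I)⁻¹)).congr_of_eventuallyEq ?_).differentiableWithinAt
  filter_upwards [Metric.ball_mem_nhds p₀ hR] with p hp
  exact cauchyHeine_eq hβ hα (hdec p.2 (hRU hp).2) h.1 (hw' p hp)

/-! ### Sectors and first integrals -/

/-- The direction `(2ℓ+1)π/k` that bisects the saddle-part `V^{ℓ,s}`. -/
def saddleDirection (k : ℕ) (ℓ : ℤ) : ℝ := (2 * ℓ + 1) * Real.pi / k

lemma saddleDirection_add {k : ℕ} (hk : 0 < k) (ℓ : ℤ) :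
    saddleDirection k (ℓ + k) = saddleDirection k ℓ + 2 * Real.pi := by
  have : (k : ℝ) ≠ 0 := by positivity
  simp only [saddleDirection]; push_cast; field_simp; ring

lemma saddlePart_eq (k : ℕ) (β r ν : ℝ) (ℓ : ℤ) : saddlePart k β r ν ℓ =
    strip r ν (saddleDirection k ℓ - β) (saddleDirection k ℓ + β) := by
  have hd : direction k (ℓ + 1) = direction k ℓ + 2 * (Real.pi / k) := by
    simp only [direction]; push_cast; ring
  have hs : saddleDirection k ℓ = direction k ℓ + Real.pi / k := by
    simp only [direction, saddleDirection]; ring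
  ext w
  have hp : 0 ≤ Real.pi / k := by positivity
  simp only [saddlePart, sector, mem_inter_iff, mem_ofPred_eq, abs_lt, mem_strip, hd, hs]
  constructor
  · rintro ⟨⟨h1, h2⟩, h3, h4⟩; constructor <;> linarith
  · rintro ⟨h1, h2⟩; refine ⟨⟨?_, ?_⟩, ?_, ?_⟩ <;> linarith

lemma sector_eq (k : ℕ) (β r ν : ℝ) (j : ℤ) : sector k β r ν j =
    strip r ν (direction k j - (Real.pi / k + β)) (direction k j + (Real.pi / k + β)) := by
  ext w
  simp only [sector, mem_ofPred_eq, abs_lt, mem_strip]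
  constructor <;> rintro ⟨h1, h2⟩ <;> constructor <;> linarith

/-- The upper edges agree for `i = 0` and the lower ones for `i = k - 1`. Hence `j, …, j+k-1` are
the labels whose transforms are all defined on `V^j`. -/
lemma sector_subset_strip {k : ℕ} {β : ℝ} (r ν : ℝ) (j : ℤ) {i : ℕ} (hi : i < k) :
    sector k β r ν j ⊆ strip r ν (saddleDirection k (j + i) - β - 2 * Real.pi)
      (saddleDirection k (j + i) + β) := by
  have hk : (0 : ℝ) < k := by exact_mod_cast hi.pos
  have hik : (i : ℝ) + 1 ≤ k := by exact_mod_cast hi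
  have hp : 0 < Real.pi / k := by positivity
  have hs : saddleDirection k (j + i) = direction k j + Real.pi / k + i * (2 * (Real.pi / k)) := by
    simp only [direction, saddleDirection]; push_cast; ring
  have hπ : Real.pi = k * (Real.pi / k) := by field_simp
  rw [sector_eq, hs]
  refine strip_mono ?_ ?_
  · have : ((i : ℝ) + 1) * (Real.pi / k) ≤ k * (Real.pi / k) :=
      mul_le_mul_of_nonneg_right hik hp.le
    linarith
  · have : 0 ≤ (i : ℝ) * (2 * (Real.pi / k)) := by positivity
    linarith

lemma isOpen_sector (k : ℕ) (β r ν : ℝ) (j : ℤ) : IsOpen (sector k β r ν j) := by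
  rw [sector_eq]; exact isOpen_strip _ _ _ _

lemma enorm_lt_ofReal {ρ : ℝ} {y : ℂ} : ‖y‖ₑ < ENNReal.ofReal ρ ↔ ‖y‖ < ρ := by
  rw [← ofReal_norm, ENNReal.ofReal_lt_ofReal_iff']
  exact ⟨fun h => h.1, fun h => ⟨h, (norm_nonneg y).trans_lt h⟩⟩

lemma sectorDom_eq (k : ℕ) (β r ν ρ : ℝ) (j : ℤ) :
    sectorDom k β r ν (ENNReal.ofReal ρ) j = sector k β r ν j ×ˢ Metric.ball 0 ρ := by
  ext p; simp [sectorDom, enorm_lt_ofReal]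

lemma saddleDom_eq (k : ℕ) (β r ν ρ : ℝ) (j : ℤ) :
    saddleDom k β r ν (ENNReal.ofReal ρ) j = saddlePart k β r ν j ×ˢ Metric.ball 0 ρ := by
  ext p; simp [saddleDom, enorm_lt_ofReal]

/-- The part of the first integral `H^ℓ` that depends only on `x`. -/
def modelIntegral (k : ℕ) (μ : ℂ) (ℓ : ℤ) (ζ : ℂ) : ℂ :=
  exp (2 * I * Real.pi * ℓ * μ / k) * exp (1 / (k * exp ζ ^ k) - μ * ζ)

lemma firstIntegral_eq (k : ℕ) (μ : ℂ) (N : ℤ → ℂ × ℂ → ℂ) (ℓ : ℤ) (p : ℂ × ℂ) :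
    firstIntegral k μ N ℓ p = p.2 * modelIntegral k μ ℓ p.1 * exp (N ℓ p) := by
  rw [firstIntegral, modelIntegral, exp_add]; ring

lemma firstIntegral_add {k : ℕ} (hk : 0 < k) (μ : ℂ) {N : ℤ → ℂ × ℂ → ℂ} {j : ℤ} {p : ℂ × ℂ}
    (hN : N (j + k) (p.1 + 2 * Real.pi * I, p.2) = N j p) :
    firstIntegral k μ N (j + k) (p.1 + 2 * Real.pi * I, p.2) = firstIntegral k μ N j p := by
  have : (k : ℂ) ≠ 0 := by exact_mod_cast hk.ne'
  simp only [firstIntegral, hN, exp_add p.1, exp_two_pi_mul_I, mul_one]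
  rw [mul_assoc p.2, mul_assoc p.2, ← exp_add, ← exp_add]
  congr 2
  push_cast; field_simp; ring

/-! ### Exponential decay of the first integrals on the saddle-parts -/

lemma cos_mul_le {k : ℕ} {β s : ℝ} {ℓ : ℤ} (hk : 0 < k) (hβ : β < Real.pi / (2 * k))
    (h1 : saddleDirection k ℓ - β < s) (h2 : s < saddleDirection k ℓ + β) :
    Real.cos (k * s) ≤ -Real.cos (k * β) := by
  have hk' : (0 : ℝ) < k := by exact_mod_cast hk
  have hc : k * saddleDirection k ℓ = ℓ * (2 * Real.pi) + Real.pi := by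
    simp only [saddleDirection]; field_simp
  rw [lt_div_iff₀ (by positivity)] at hβ
  have e : (k : ℝ) * s = k * (s - saddleDirection k ℓ) + Real.pi + ℓ * (2 * Real.pi) := by
    rw [mul_sub, hc]; ring
  rw [e, Real.cos_add_int_mul_two_pi, Real.cos_add_pi, neg_le_neg_iff,
    ← Real.cos_abs (k * (s - saddleDirection k ℓ))]
  refine Real.cos_le_cos_of_nonneg_of_le_pi (abs_nonneg _) ?_ ?_
  · nlinarith [Real.pi_pos]
  · rw [abs_mul, abs_of_pos hk']
    exact mul_le_mul_of_nonneg_left (abs_le.2 ⟨by linarith, by linarith⟩) hk'.le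

/-- Outside the disc `x^{-k}` is bounded, and along a spiral `Re(μ log x)` grows with slope `Re μ -
ν Im μ`. -/
lemma exponent_le_of_le {k : ℕ} (hk : 0 < k) {a m ν L x t : ℝ} (hα : 0 < a - ν * m)
    (h : L ≤ t) :
    Real.exp (-(k * t)) * Real.cos x / k - (a * t - m * (ν * (t - L))) ≤
      Real.exp (-(k * L)) / k + |m * ν * L| + 2 * (a - ν * m) * |L| - (a - ν * m) * |t| := by
  have hk' : (0 : ℝ) < k := by exact_mod_cast hk
  have h1 : Real.exp (-(k * t)) * Real.cos x / k ≤ Real.exp (-(k * L)) / k := by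
    refine div_le_div_of_nonneg_right ?_ hk'.le
    refine (mul_le_of_le_one_right (Real.exp_pos _).le (Real.cos_le_one _)).trans ?_
    exact Real.exp_le_exp.2 (neg_le_neg (mul_le_mul_of_nonneg_left h hk'.le))
  have h2 : |t| - t ≤ 2 * |L| := by
    rcases le_total 0 t with h0 | h0
    · rw [abs_of_nonneg h0]; linarith [abs_nonneg L]
    · have : |t| ≤ |L| := abs_le_abs_of_nonpos h0 h
      rw [abs_of_nonpos h0] at this ⊢
      linarith
  have h2' := mul_le_mul_of_nonneg_left h2 hα.le
  have h3 := neg_abs_le (m * ν * L)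
  have h4 : -(a * t - m * (ν * (t - L))) = -((a - ν * m) * t) - m * ν * L := by ring
  have h5 : (a - ν * m) * (|t| - t) = (a - ν * m) * |t| - (a - ν * m) * t := by ring
  linarith

/-- Inside the disc the term `-κ e^{-kt}/k` beats any linear function as `t → -∞`; the explicit
constant comes from `e^{-kt} ≥ t²/2` and completing the square. -/
lemma exponent_le_of_ge {k : ℕ} (hk : 0 < k) {a α κ L x t : ℝ} (hα : 0 < α) (hκ : 0 < κ)
    (hx : Real.cos x ≤ -κ) (h : t ≤ L) :
    Real.exp (-(k * t)) * Real.cos x / k - a * t ≤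
      (α + |a|) * |L| + (α + |a|) ^ 2 * k / (2 * κ) - α * |t| := by
  have hk' : (0 : ℝ) < k := by exact_mod_cast hk
  have hk1 : (1 : ℝ) ≤ k := by exact_mod_cast hk
  have h1 : Real.exp (-(k * t)) * Real.cos x / k ≤ -(κ * Real.exp (-(k * t)) / k) := by
    rw [← neg_div]
    refine div_le_div_of_nonneg_right ?_ hk'.le
    have := mul_le_mul_of_nonneg_left hx (Real.exp_pos (-(k * t))).le
    linarith
  have h2 : α * |t| - a * t ≤ (α + |a|) * |t| := by
    have := neg_abs_le (a * t)
    rw [abs_mul] at this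
    linarith
  generalize hA : α + |a| = A at *
  have hA0 : 0 ≤ A := by rw [← hA]; positivity
  have h6 : 0 ≤ A ^ 2 * k / (2 * κ) := by positivity
  have h7 : 0 ≤ A * |L| := by positivity
  rcases le_total 0 t with h0 | h0
  · have h3 : |t| ≤ |L| := by rw [abs_of_nonneg h0]; exact h.trans (le_abs_self _)
    have h4 : A * |t| ≤ A * |L| := mul_le_mul_of_nonneg_left h3 hA0
    have h5 : 0 ≤ κ * Real.exp (-(k * t)) / k := by positivity
    linarith
  · rw [abs_of_nonpos h0] at h2 ⊢
    have h3 : (-t) ^ 2 / 2 ≤ Real.exp (-(k * t)) := by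
      have h4 := Real.quadratic_le_exp_of_nonneg (neg_nonneg.2 h0)
      have h5 : Real.exp (-t) ≤ Real.exp (-(k * t)) := Real.exp_le_exp.2 (by nlinarith)
      linarith
    have h4 : κ * ((-t) ^ 2 / 2) / k ≤ κ * Real.exp (-(k * t)) / k := by gcongr
    have h5 : κ * ((-t) ^ 2 / 2) / k + A ^ 2 * k / (2 * κ) - A * -t =
        (κ * -t - A * k) ^ 2 / (2 * κ * k) := by field_simp; ring
    have h8 : 0 ≤ (κ * -t - A * k) ^ 2 / (2 * κ * k) := by positivity
    linarith

theorem exists_norm_modelIntegral_le {k : ℕ} (hk : 0 < k) {μ : ℂ} {β ν : ℝ} (r : ℝ)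
    (hβ0 : 0 < β) (hβ : β < Real.pi / (2 * k)) (hν : ν * μ.im < μ.re) :
    ∃ B, 0 ≤ B ∧ ∀ ℓ, ∀ ζ ∈ saddlePart k β r ν ℓ,
      ‖modelIntegral k μ ℓ ζ‖ ≤ B * Real.exp (-(μ.re - ν * μ.im) * |ζ.re|) := by
  have hk' : (0 : ℝ) < k := by exact_mod_cast hk
  have hk1 : (1 : ℝ) ≤ k := by exact_mod_cast hk
  have hπ := Real.pi_pos
  have hkβ : k * β < Real.pi / 2 := by
    rw [lt_div_iff₀ (by positivity)] at hβ
    linarith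
  set κ := Real.cos (k * β) with hκ
  have hκ0 : 0 < κ := Real.cos_pos_of_mem_Ioo ⟨by nlinarith, hkβ⟩
  set α := μ.re - ν * μ.im with hα
  have hα0 : 0 < α := sub_pos.2 hν
  set L := Real.log r with hL
  obtain ⟨b₁, hb₁⟩ : ∃ b, b = Real.exp (-(k * L)) / k + |μ.im * ν * L| + 2 * α * |L| := ⟨_, rfl⟩
  obtain ⟨b₂, hb₂⟩ : ∃ b, b = (α + |μ.re|) * |L| + (α + |μ.re|) ^ 2 * k / (2 * κ) := ⟨_, rfl⟩
  have hb₁0 : 0 ≤ b₁ := by rw [hb₁]; positivity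
  have hb₂0 : 0 ≤ b₂ := by rw [hb₂]; positivity
  refine ⟨Real.exp (|μ.im| * (2 * Real.pi) + b₁ + b₂), (Real.exp_pos _).le, fun ℓ ζ hζ => ?_⟩
  rw [saddlePart_eq, mem_strip] at hζ
  set s := spiralArg r ν ζ with hs
  set t := ζ.re with ht
  have him : ζ.im = s + ν * max 0 (t - L) := by rw [hs, spiralArg]; ring
  -- The factor `e^{2πiℓμ/k}` compensates the growth of the argument with `ℓ`, which makes the bound
  -- uniform over all integer labels.
  have hang : |s - 2 * Real.pi * ℓ / k| ≤ 2 * Real.pi := by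
    have h1 : saddleDirection k ℓ = 2 * Real.pi * ℓ / k + Real.pi / k := by
      simp only [saddleDirection]; ring
    have h2 : Real.pi / k ≤ Real.pi := div_le_self hπ.le hk1
    have h3 : Real.pi / (2 * k) ≤ Real.pi := div_le_self hπ.le (by linarith)
    have h4 : 0 < Real.pi / k := by positivity
    rw [abs_le]; constructor <;> linarith [hζ.1, hζ.2]
  have hmi : μ.im * (s - 2 * Real.pi * ℓ / k) ≤ |μ.im| * (2 * Real.pi) :=
    (le_abs_self _).trans (by rw [abs_mul]; exact mul_le_mul_of_nonneg_left hang (abs_nonneg _))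
  have hinv : (1 : ℂ) / (k * exp ζ ^ k) = exp (-(k * ζ)) / k := by
    rw [← exp_nat_mul, exp_neg]; field_simp
  have hre : (exp (-(k * ζ)) / (k : ℂ)).re = Real.exp (-(k * t)) * Real.cos (k * ζ.im) / k := by
    rw [div_natCast_re, exp_re]
    simp [ht]
  have hre2 : (2 * I * Real.pi * ℓ * μ / k : ℂ).re = -(μ.im * (2 * Real.pi * ℓ / k)) := by
    rw [div_natCast_re]
    have : (2 * I * Real.pi * ℓ * μ : ℂ) = ((2 * Real.pi * ℓ : ℝ) : ℂ) * (I * μ) := by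
      push_cast; ring
    rw [this, re_ofReal_mul]; simp; ring
  rw [modelIntegral, norm_mul, norm_exp, norm_exp, ← Real.exp_add, ← Real.exp_add, hinv, sub_re,
    hre, hre2, mul_re]
  refine Real.exp_le_exp.2 ?_
  rw [← ht, him]
  have hmain : Real.exp (-(k * t)) * Real.cos (k * (s + ν * max 0 (t - L))) / k
      - (μ.re * t - μ.im * (ν * max 0 (t - L))) ≤ b₁ + b₂ - α * |t| := by
    rcases le_total L t with h | h
    · rw [max_eq_right (sub_nonneg.2 h)]
      have := exponent_le_of_le hk (x := k * (s + ν * (t - L))) hα0 h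
      rw [← hα, ← hb₁] at this
      linarith
    · rw [max_eq_left (sub_nonpos.2 h), mul_zero, mul_zero, add_zero, sub_zero]
      have := exponent_le_of_ge hk (a := μ.re) hα0 hκ0 (cos_mul_le hk hβ hζ.1 hζ.2) h
      rw [← hb₂] at this
      linarith
  have e : μ.im * (s + ν * max 0 (t - L)) = μ.im * s + μ.im * (ν * max 0 (t - L)) := by ring
  have e2 : μ.im * (s - 2 * Real.pi * ℓ / k) = μ.im * s - μ.im * (2 * Real.pi * ℓ / k) := by ring
  linarith

/-! ### The Cauchy-Heine operator on small collections -/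

/-- Quantitative smallness of the data: the first integrals are bounded by `3 B ρ` on the
saddle-parts, where `φ` is `L`-Lipschitz. -/
structure IsSmallData (k : ℕ) (μ : ℂ) (β r ν : ℝ) (φ : ZMod k → ℂ → ℂ) (α B R L ρ : ℝ) :
    Prop where
  hk : 0 < k
  hβ0 : 0 < β
  hβ : β < Real.pi / (2 * k)
  hα : 0 < α
  hB : 0 ≤ B
  hL : 0 ≤ L
  hρ : 0 < ρ
  modelIntegral_le : ∀ ℓ, ∀ ζ ∈ saddlePart k β r ν ℓ,
    ‖modelIntegral k μ ℓ ζ‖ ≤ B * Real.exp (-α * |ζ.re|)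
  small : 3 * B * ρ < R
  differentiableOn : ∀ j, DifferentiableOn ℂ (φ j) (Metric.ball 0 R)
  map_zero : ∀ j, φ j 0 = 0
  lipschitz : ∀ j, ∀ h ∈ Metric.ball (0 : ℂ) R, ∀ h' ∈ Metric.ball (0 : ℂ) R,
    ‖φ j h - φ j h'‖ ≤ L * ‖h - h'‖

/-- A collection of holomorphic functions bounded by `1`. -/
structure IsSmallCollection (k : ℕ) (β r ν ρ : ℝ) (N : ℤ → ℂ × ℂ → ℂ) : Prop where
  holomorphic : ∀ j, DifferentiableOn ℂ (N j) (sector k β r ν j ×ˢ Metric.ball 0 ρ)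
  norm_le : ∀ j, ∀ p ∈ sector k β r ν j ×ˢ Metric.ball (0 : ℂ) ρ, ‖N j p‖ ≤ 1
  periodic : ∀ j, ∀ p ∈ sector k β r ν j ×ˢ Metric.ball (0 : ℂ) ρ,
    N (j + k) (p.1 + 2 * Real.pi * I, p.2) = N j p

/-- The refined Cauchy-Heine transform `Σ(N, f)`. -/
def cauchyHeineSum (k : ℕ) (μ : ℂ) (β r ν : ℝ) (N : ℤ → ℂ × ℂ → ℂ) (f : ZMod k → ℂ → ℂ)
    (j : ℤ) (p : ℂ × ℂ) : ℂ :=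
  ∑ i ∈ Finset.range k, cauchyHeine r ν β (saddleDirection k (j + i))
    (fun ζ => f ((j + i : ℤ) : ZMod k) (firstIntegral k μ N (j + i) (ζ, p.2))) p.1

lemma norm_exp_le_three {z : ℂ} (hz : ‖z‖ ≤ 1) : ‖exp z‖ ≤ 3 := by
  rw [norm_exp]
  have h1 : z.re ≤ 1 := (le_abs_self _).trans ((abs_re_le_norm z).trans hz)
  have := Real.exp_le_exp.2 h1
  linarith [Real.exp_one_lt_d9]

lemma norm_exp_sub_exp_le {z z' : ℂ} (hz : ‖z‖ ≤ 1) (hz' : ‖z'‖ ≤ 1) :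
    ‖exp z - exp z'‖ ≤ 3 * ‖z - z'‖ :=
  (convex_closedBall (0 : ℂ) 1).norm_image_sub_le_of_norm_deriv_le (f := exp)
    (fun x _ => differentiableAt_exp) (fun x hx => by
      rw [Complex.deriv_exp]
      exact norm_exp_le_three (mem_closedBall_zero_iff.1 hx))
    (mem_closedBall_zero_iff.2 hz') (mem_closedBall_zero_iff.2 hz)

section
variable {k : ℕ} {μ : ℂ} {β r ν : ℝ} {φ : ZMod k → ℂ → ℂ} {α B R L ρ : ℝ}
  {N N' : ℤ → ℂ × ℂ → ℂ}

lemma IsSmallData.le_pi (S : IsSmallData k μ β r ν φ α B R L ρ) : β ≤ Real.pi := by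
  have hk1 : (1 : ℝ) ≤ k := by exact_mod_cast S.hk
  exact S.hβ.le.trans (div_le_self Real.pi_pos.le (by linarith))

lemma IsSmallData.norm_firstIntegral_le (S : IsSmallData k μ β r ν φ α B R L ρ)
    (hN : IsSmallCollection k β r ν ρ N) {ℓ : ℤ} {p : ℂ × ℂ}
    (hp : p ∈ saddlePart k β r ν ℓ ×ˢ Metric.ball (0 : ℂ) ρ) :
    ‖firstIntegral k μ N ℓ p‖ ≤ 3 * B * ρ * Real.exp (-α * |p.1.re|) := by
  have h1 := S.modelIntegral_le ℓ p.1 hp.1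
  have h2 := norm_exp_le_three (hN.norm_le ℓ p ⟨hp.1.1, hp.2⟩)
  have h3 : ‖p.2‖ ≤ ρ := (mem_ball_zero_iff.1 hp.2).le
  have hB := S.hB
  have hρ := S.hρ
  rw [firstIntegral_eq, norm_mul, norm_mul]
  calc ‖p.2‖ * ‖modelIntegral k μ ℓ p.1‖ * ‖exp (N ℓ p)‖
      ≤ ρ * (B * Real.exp (-α * |p.1.re|)) * 3 := by gcongr
    _ = _ := by ring

lemma IsSmallData.firstIntegral_mem (S : IsSmallData k μ β r ν φ α B R L ρ)
    (hN : IsSmallCollection k β r ν ρ N) {ℓ : ℤ} {p : ℂ × ℂ}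
    (hp : p ∈ saddlePart k β r ν ℓ ×ˢ Metric.ball (0 : ℂ) ρ) :
    firstIntegral k μ N ℓ p ∈ Metric.ball (0 : ℂ) R := by
  have hα := S.hα
  have hB := S.hB
  have hρ := S.hρ
  rw [mem_ball_zero_iff]
  refine (S.norm_firstIntegral_le hN hp).trans_lt (lt_of_le_of_lt ?_ S.small)
  refine mul_le_of_le_one_right (by positivity) (Real.exp_le_one_iff.2 ?_)
  nlinarith [abs_nonneg p.1.re]

lemma IsSmallData.norm_comp_firstIntegral_le (S : IsSmallData k μ β r ν φ α B R L ρ)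
    (hN : IsSmallCollection k β r ν ρ N) {ℓ : ℤ} {p : ℂ × ℂ}
    (hp : p ∈ saddlePart k β r ν ℓ ×ˢ Metric.ball (0 : ℂ) ρ) :
    ‖φ ℓ (firstIntegral k μ N ℓ p)‖ ≤ L * (3 * B * ρ) * Real.exp (-α * |p.1.re|) := by
  have h0 : (0 : ℂ) ∈ Metric.ball (0 : ℂ) R :=
    Metric.mem_ball_self ((norm_nonneg _).trans_lt
      (mem_ball_zero_iff.1 (S.firstIntegral_mem hN hp)))
  have h := S.lipschitz ℓ _ (S.firstIntegral_mem hN hp) 0 h0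
  rw [S.map_zero, sub_zero, sub_zero] at h
  rw [mul_assoc]
  exact h.trans (mul_le_mul_of_nonneg_left (S.norm_firstIntegral_le hN hp) S.hL)

/-- The constant `L (3Bρ)` is the same as in the bound of `φ(H)` itself: `3` bounds both `|e^z|` and
the Lipschitz constant of `exp` on the unit disc. -/
lemma IsSmallData.norm_comp_firstIntegral_sub_le (S : IsSmallData k μ β r ν φ α B R L ρ)
    (hN : IsSmallCollection k β r ν ρ N) (hN' : IsSmallCollection k β r ν ρ N') {ℓ : ℤ}
    {p : ℂ × ℂ} (hp : p ∈ saddlePart k β r ν ℓ ×ˢ Metric.ball (0 : ℂ) ρ) {d : ℝ}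
    (hd : ‖N ℓ p - N' ℓ p‖ ≤ d) :
    ‖φ ℓ (firstIntegral k μ N ℓ p) - φ ℓ (firstIntegral k μ N' ℓ p)‖ ≤
      L * (3 * B * ρ) * d * Real.exp (-α * |p.1.re|) := by
  have h := S.lipschitz ℓ _ (S.firstIntegral_mem hN hp) _ (S.firstIntegral_mem hN' hp)
  have h1 := S.modelIntegral_le ℓ p.1 hp.1
  have h2 := norm_exp_sub_exp_le (hN.norm_le ℓ p ⟨hp.1.1, hp.2⟩) (hN'.norm_le ℓ p ⟨hp.1.1, hp.2⟩)
  have h3 : ‖p.2‖ ≤ ρ := (mem_ball_zero_iff.1 hp.2).le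
  have hB := S.hB
  have hρ := S.hρ
  have hL := S.hL
  have hd0 := (norm_nonneg _).trans hd
  refine h.trans ?_
  rw [firstIntegral_eq, firstIntegral_eq, ← mul_sub, norm_mul, norm_mul]
  calc L * (‖p.2‖ * ‖modelIntegral k μ ℓ p.1‖ * ‖exp (N ℓ p) - exp (N' ℓ p)‖)
      ≤ L * (ρ * (B * Real.exp (-α * |p.1.re|)) * (3 * d)) := by
        gcongr
        exact h2.trans (by gcongr)
    _ = _ := by ring

lemma differentiableAt_modelIntegral (k : ℕ) (μ : ℂ) (ℓ : ℤ) (ζ : ℂ) (hk : 0 < k) :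
    DifferentiableAt ℂ (modelIntegral k μ ℓ) ζ := by
  have hk' : (k : ℂ) ≠ 0 := by exact_mod_cast hk.ne'
  have : (k : ℂ) * exp ζ ^ k ≠ 0 := mul_ne_zero hk' (pow_ne_zero _ (exp_ne_zero _))
  unfold modelIntegral
  fun_prop (disch := assumption)

lemma IsSmallData.differentiableOn_comp_firstIntegral (S : IsSmallData k μ β r ν φ α B R L ρ)
    (hN : IsSmallCollection k β r ν ρ N) (ℓ : ℤ) :
    DifferentiableOn ℂ (fun p => φ ℓ (firstIntegral k μ N ℓ p))
      (saddlePart k β r ν ℓ ×ˢ Metric.ball (0 : ℂ) ρ) := by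
  refine (S.differentiableOn ℓ).comp (t := Metric.ball 0 R) ?_
    fun p hp => S.firstIntegral_mem hN hp
  rw [show firstIntegral k μ N ℓ = _ from funext (firstIntegral_eq k μ N ℓ)]
  refine DifferentiableOn.mul (DifferentiableOn.mul (by fun_prop) fun p _ => ?_)
    ((hN.holomorphic ℓ).mono fun p hp => ⟨hp.1.1, hp.2⟩).cexp
  exact (DifferentiableAt.comp (g := modelIntegral k μ ℓ) (f := fun p : ℂ × ℂ => p.1) p
    (differentiableAt_modelIntegral k μ ℓ p.1 S.hk) (by fun_prop)).differentiableWithinAt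

lemma IsSmallData.isDecaying (S : IsSmallData k μ β r ν φ α B R L ρ)
    (hN : IsSmallCollection k β r ν ρ N) (ℓ : ℤ) {y : ℂ} (hy : y ∈ Metric.ball (0 : ℂ) ρ) :
    IsDecaying r ν β (saddleDirection k ℓ) α (L * (3 * B * ρ))
      fun ζ => φ ℓ (firstIntegral k μ N ℓ (ζ, y)) := by
  constructor
  · rw [← saddlePart_eq]
    exact (S.differentiableOn_comp_firstIntegral hN ℓ).comp
      (f := fun ζ : ℂ => (ζ, y)) (by fun_prop) fun ζ hζ => ⟨hζ, hy⟩
  · rw [← saddlePart_eq]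
    exact fun ζ hζ => S.norm_comp_firstIntegral_le hN (p := (ζ, y)) ⟨hζ, hy⟩

lemma IsSmallData.comp_firstIntegral_add (S : IsSmallData k μ β r ν φ α B R L ρ)
    (hN : IsSmallCollection k β r ν ρ N) (ℓ : ℤ) {y ζ : ℂ} (hy : y ∈ Metric.ball (0 : ℂ) ρ)
    (hζ : ζ ∈ saddlePart k β r ν ℓ) :
    φ ((ℓ + k : ℤ) : ZMod k) (firstIntegral k μ N (ℓ + k) (ζ + 2 * Real.pi * I, y)) =
      φ ℓ (firstIntegral k μ N ℓ (ζ, y)) := by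
  rw [firstIntegral_add S.hk μ (p := (ζ, y)) (hN.periodic ℓ (ζ, y) ⟨hζ.1, hy⟩)]
  simp

lemma IsSmallData.cauchyHeine_add (S : IsSmallData k μ β r ν φ α B R L ρ)
    (hN : IsSmallCollection k β r ν ρ N) (ℓ : ℤ) {y w : ℂ} (hy : y ∈ Metric.ball (0 : ℂ) ρ)
    (hw : w ∈ strip r ν (saddleDirection k ℓ - β - 2 * Real.pi) (saddleDirection k ℓ + β)) :
    cauchyHeine r ν β (saddleDirection k (ℓ + k))
      (fun ζ => φ ((ℓ + k : ℤ) : ZMod k) (firstIntegral k μ N (ℓ + k) (ζ, y)))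
        (w + 2 * Real.pi * I) =
    cauchyHeine r ν β (saddleDirection k ℓ) (fun ζ => φ ℓ (firstIntegral k μ N ℓ (ζ, y))) w := by
  rw [saddleDirection_add S.hk]
  refine cauchyHeine_add_two_pi S.hβ0 (fun ζ hζ => ?_) hw
  rw [← saddlePart_eq] at hζ
  exact S.comp_firstIntegral_add hN ℓ hy hζ

theorem IsSmallData.differentiableOn_cauchyHeineSum (S : IsSmallData k μ β r ν φ α B R L ρ)
    (hN : IsSmallCollection k β r ν ρ N) (j : ℤ) :
    DifferentiableOn ℂ (cauchyHeineSum k μ β r ν N φ j)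
      (sector k β r ν j ×ˢ Metric.ball 0 ρ) := by
  refine DifferentiableOn.fun_sum fun i hi => ?_
  have h1 := S.differentiableOn_comp_firstIntegral hN (j + i)
  have h2 := fun p (hp : p ∈ saddlePart k β r ν (j + i) ×ˢ Metric.ball (0 : ℂ) ρ) =>
    S.norm_comp_firstIntegral_le hN hp
  rw [saddlePart_eq] at h1 h2
  exact (differentiableOn_cauchyHeine S.hβ0 S.hα h1 h2).mono
    (prod_mono (sector_subset_strip r ν j (Finset.mem_range.1 hi)) subset_rfl)

theorem IsSmallData.norm_cauchyHeineSum_le (S : IsSmallData k μ β r ν φ α B R L ρ) {C : ℝ}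
    (hC : ∀ (c M : ℝ) (g : ℂ → ℂ) (w : ℂ), IsDecaying r ν β c α M g →
      w ∈ strip r ν (c - β - 2 * Real.pi) (c + β) → ‖cauchyHeine r ν β c g w‖ ≤ C * M)
    (hN : IsSmallCollection k β r ν ρ N) {j : ℤ} {p : ℂ × ℂ}
    (hp : p ∈ sector k β r ν j ×ˢ Metric.ball (0 : ℂ) ρ) :
    ‖cauchyHeineSum k μ β r ν N φ j p‖ ≤ k * (C * (L * (3 * B * ρ))) := by
  rw [cauchyHeineSum]
  refine (norm_sum_le_of_le (n := fun _ => C * (L * (3 * B * ρ))) _ fun i hi => ?_).trans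
    (by simp)
  exact hC _ _ _ _ (S.isDecaying hN _ hp.2)
    (sector_subset_strip r ν j (Finset.mem_range.1 hi) hp.1)

theorem IsSmallData.norm_cauchyHeineSum_sub_le (S : IsSmallData k μ β r ν φ α B R L ρ) {C : ℝ}
    (hC : ∀ (c M : ℝ) (g : ℂ → ℂ) (w : ℂ), IsDecaying r ν β c α M g →
      w ∈ strip r ν (c - β - 2 * Real.pi) (c + β) → ‖cauchyHeine r ν β c g w‖ ≤ C * M)
    (hN : IsSmallCollection k β r ν ρ N) (hN' : IsSmallCollection k β r ν ρ N') {d : ℝ}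
    (hd : ∀ j, ∀ p ∈ sector k β r ν j ×ˢ Metric.ball (0 : ℂ) ρ, ‖N j p - N' j p‖ ≤ d)
    {j : ℤ} {p : ℂ × ℂ} (hp : p ∈ sector k β r ν j ×ˢ Metric.ball (0 : ℂ) ρ) :
    ‖cauchyHeineSum k μ β r ν N φ j p - cauchyHeineSum k μ β r ν N' φ j p‖ ≤
      k * (C * (L * (3 * B * ρ))) * d := by
  rw [cauchyHeineSum, cauchyHeineSum, ← Finset.sum_sub_distrib]
  refine (norm_sum_le_of_le (n := fun _ => C * (L * (3 * B * ρ) * d)) _ fun i hi => ?_).trans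
    (by simp [mul_assoc])
  have hw := sector_subset_strip r ν j (Finset.mem_range.1 hi) hp.1
  have h1 := S.isDecaying hN (j + i) hp.2
  have h2 := S.isDecaying hN' (j + i) hp.2
  rw [← cauchyHeine_sub S.hβ0 S.hα h1 h2 hw]
  refine hC _ _ _ _ ⟨h1.differentiableOn.sub h2.differentiableOn, ?_⟩ hw
  rw [← saddlePart_eq]
  exact fun ζ hζ => S.norm_comp_firstIntegral_sub_le hN hN' (p := (ζ, p.2)) ⟨hζ, hp.2⟩
    (hd _ _ ⟨hζ.1, hp.2⟩)

theorem IsSmallData.cauchyHeineSum_add (S : IsSmallData k μ β r ν φ α B R L ρ)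
    (hN : IsSmallCollection k β r ν ρ N) {j : ℤ} {p : ℂ × ℂ}
    (hp : p ∈ sector k β r ν j ×ˢ Metric.ball (0 : ℂ) ρ) :
    cauchyHeineSum k μ β r ν N φ (j + k) (p.1 + 2 * Real.pi * I, p.2) =
      cauchyHeineSum k μ β r ν N φ j p := by
  refine Finset.sum_congr rfl fun i hi => ?_
  rw [show j + (k : ℤ) + i = (j + i) + k by ring]
  exact S.cauchyHeine_add hN (j + i) hp.2
    (sector_subset_strip r ν j (Finset.mem_range.1 hi) hp.1)

/-- Passing from `j` to `j + 1` replaces the label `j` by `j + k`. The transform with label `j + k`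
at `w` is the one with label `j` at `w - 2πi`, so the difference is the jump of a single transform.
-/
theorem IsSmallData.cauchyHeineSum_jump (S : IsSmallData k μ β r ν φ α B R L ρ)
    (hN : IsSmallCollection k β r ν ρ N) {j : ℤ} {p : ℂ × ℂ}
    (hp : p ∈ saddlePart k β r ν j ×ˢ Metric.ball (0 : ℂ) ρ) :
    cauchyHeineSum k μ β r ν N φ (j + 1) p - cauchyHeineSum k μ β r ν N φ j p =
      φ j (firstIntegral k μ N j p) := by
  set A : ℤ → ℂ := fun ℓ => cauchyHeine r ν β (saddleDirection k ℓ)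
    (fun ζ => φ (ℓ : ZMod k) (firstIntegral k μ N ℓ (ζ, p.2))) p.1 with hA
  have e1 : cauchyHeineSum k μ β r ν N φ (j + 1) p = ∑ i ∈ Finset.range k, A (j + (i + 1 : ℕ)) :=
    Finset.sum_congr rfl fun i _ => by
      rw [show j + ((i + 1 : ℕ) : ℤ) = j + 1 + i by push_cast; ring]
  have e2 : cauchyHeineSum k μ β r ν N φ j p = ∑ i ∈ Finset.range k, A (j + i) := rfl
  have e3 := (Finset.sum_range_succ (fun i : ℕ => A (j + i)) k).symm.trans
    (Finset.sum_range_succ' (fun i : ℕ => A (j + i)) k)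
  have hw : p.1 ∈ strip r ν (saddleDirection k j - β) (saddleDirection k j + β) := by
    rw [← saddlePart_eq]; exact hp.1
  have hs : spiralArg r ν (p.1 - 2 * Real.pi * I) = spiralArg r ν p.1 - 2 * Real.pi := by
    have := spiralArg_add_mul_I r ν p.1 (-(2 * Real.pi))
    push_cast at this
    rw [sub_eq_add_neg, ← neg_mul, this]; ring
  have hw' : p.1 - 2 * Real.pi * I ∈
      strip r ν (saddleDirection k j - β - 2 * Real.pi) (saddleDirection k j + β) := by
    rw [mem_strip] at hw ⊢
    rw [hs]
    constructor <;> linarith [Real.pi_pos]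
  have e4 := S.cauchyHeine_add hN j hp.2 hw'
  rw [sub_add_cancel] at e4
  have e5 := cauchyHeine_sub_two_pi_I S.hβ0 S.le_pi S.hα (S.isDecaying hN j hp.2) hw
  rw [← e4] at e5
  have e6 : A (j + k) - A j = φ j (firstIntegral k μ N j p) := e5
  rw [e1, e2, ← e6]
  simp only [Nat.cast_zero, add_zero] at e3
  linear_combination -e3

end

/-! ### The Cauchy-Heine operator as a sum of integrals -/

section
variable {k : ℕ} {μ : ℂ} {β r ν : ℝ} {φ : ZMod k → ℂ → ℂ} {α B R L ρ : ℝ}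
  {N : ℤ → ℂ × ℂ → ℂ}

lemma cauchyHeineIntegrand_eq (k : ℕ) (μ : ℂ) (r ν : ℝ) (N : ℤ → ℂ × ℂ → ℂ)
    (f : ZMod k → ℂ → ℂ) (ℓ : ℤ) (δ : ℝ) (w y : ℂ) (t : ℝ) :
    cauchyHeineIntegrand k μ r ν N f ℓ δ (exp w) y t = (exp w)⁻¹ *
      ((fun ζ => f ℓ (firstIntegral k μ N ℓ (ζ, y)) * kernel (ζ - w))
        (contour r ν (saddleDirection k ℓ + δ) t) * contourSpeed r ν t) := by
  have hx := exp_ne_zero w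
  have hz := exp_ne_zero (contour r ν (saddleDirection k ℓ + δ) t)
  have hk : kernel (contour r ν (saddleDirection k ℓ + δ) t - w) =
      (exp (contour r ν (saddleDirection k ℓ + δ) t) - exp w)⁻¹ * exp w := by
    rw [kernel, exp_sub, div_sub_one hx, inv_div, div_eq_mul_inv, mul_comm]
  rw [cauchyHeineIntegrand]
  simp only [hk]
  change f ℓ (firstIntegral k μ N ℓ (contour r ν (saddleDirection k ℓ + δ) t, y)) /
    (exp (contour r ν (saddleDirection k ℓ + δ) t) *
      (exp (contour r ν (saddleDirection k ℓ + δ) t) - exp w)) *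
    (exp (contour r ν (saddleDirection k ℓ + δ) t) * contourSpeed r ν t) = _
  rw [div_eq_mul_inv, mul_inv]
  field_simp

lemma IsSmallData.cauchyHeineIntegrand_add (S : IsSmallData k μ β r ν φ α B R L ρ)
    (hN : IsSmallCollection k β r ν ρ N) (ℓ : ℤ) {δ : ℝ} (hδ : |δ| < β) {y : ℂ}
    (hy : y ∈ Metric.ball (0 : ℂ) ρ) (w : ℂ) :
    cauchyHeineIntegrand k μ r ν N φ (ℓ + k) δ (exp w) y =
      cauchyHeineIntegrand k μ r ν N φ ℓ δ (exp w) y := by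
  ext t
  rw [cauchyHeineIntegrand_eq, cauchyHeineIntegrand_eq]
  have hc : contour r ν (saddleDirection k (ℓ + k) + δ) t =
      contour r ν (saddleDirection k ℓ + δ) t + 2 * Real.pi * I := by
    rw [saddleDirection_add S.hk, add_right_comm, contour_add]; push_cast; ring
  rw [abs_lt] at hδ
  have hmem : contour r ν (saddleDirection k ℓ + δ) t ∈ saddlePart k β r ν ℓ := by
    rw [saddlePart_eq]
    exact contour_mem_strip t ⟨by linarith [hδ.1], by linarith [hδ.2]⟩
  simp only [hc]
  rw [S.comp_firstIntegral_add hN ℓ hy hmem, add_sub_right_comm, kernel_add_two_pi_I]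

/-- Only the two paths next to `x` need the conditions on `δ`: `h2` for `i = 0`, and `h1` for `i = k
- 1`, whose label is `j - 1` modulo `k`. The others are kept away from `x` by `2β < π/k`. -/
lemma saddleDirection_add_mem {i : ℕ} (hk : 0 < k) (hβ : β < Real.pi / (2 * k))
    (hi : i < k) {j : ℤ} {s : ℝ} (δ : ZMod k → ℝ) (hδ : ∀ ℓ, |δ ℓ| < β)
    (hs : |s - direction k j| < Real.pi / k + β)
    (h1 : (2 * j - 1) * Real.pi / k + δ ((j - 1 : ℤ) : ZMod k) < s)
    (h2 : s < (2 * j + 1) * Real.pi / k + δ (j : ZMod k)) :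
    saddleDirection k (j + i) + δ ((j + i : ℤ) : ZMod k) ∈ Ioo s (s + 2 * Real.pi) := by
  have hk' : (0 : ℝ) < k := by exact_mod_cast hk
  have hπ := Real.pi_pos
  have hP : 0 < Real.pi / k := by positivity
  have hβ' : 2 * β < Real.pi / k := by
    have : Real.pi / (2 * k) = Real.pi / k / 2 := by field_simp
    linarith
  have hkP : (k : ℝ) * (Real.pi / k) = Real.pi := by field_simp
  have hd : direction k j = 2 * j * (Real.pi / k) := by simp only [direction]; ring
  have hsd : saddleDirection k (j + i) = (2 * j + 1) * (Real.pi / k) + 2 * (i * (Real.pi / k)) := by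
    simp only [saddleDirection]; push_cast; ring
  have hδi := abs_lt.1 (hδ ((j + i : ℤ) : ZMod k))
  rw [abs_lt, hd] at hs
  rw [mul_div_assoc] at h1 h2
  rw [hsd]
  constructor
  · rcases Nat.eq_zero_or_pos i with rfl | h0
    · simpa using h2
    · have : (1 : ℝ) ≤ i := by exact_mod_cast h0
      have := mul_le_mul_of_nonneg_right this hP.le
      linarith [hδi.1, hs.2]
  · rcases eq_or_ne (i + 1) k with h0 | h0
    · have hcast : ((j + i : ℤ) : ZMod k) = ((j - 1 : ℤ) : ZMod k) := by
        have : ((i + 1 : ℕ) : ZMod k) = 0 := by rw [h0]; simp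
        push_cast at this ⊢
        linear_combination this
      have h3 : ((i : ℝ) + 1) * (Real.pi / k) = Real.pi := by
        have : (i : ℝ) + 1 = k := by exact_mod_cast h0
        rw [this, hkP]
      rw [hcast]
      linarith
    · have h4 : i + 2 ≤ k := by omega
      have : (i : ℝ) + 2 ≤ k := by exact_mod_cast h4
      have := mul_le_mul_of_nonneg_right this hP.le
      linarith [hδi.2, hs.1]

lemma sum_range_add_of_periodic {M : Type*} [AddCommGroup M] {P : ℤ → M} {k : ℕ}
    (hP : ∀ ℓ, P (ℓ + k) = P ℓ) (j : ℤ) :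
    ∑ i ∈ Finset.range k, P (j + i) = ∑ i ∈ Finset.range k, P i := by
  have step : ∀ j, ∑ i ∈ Finset.range k, P (j + 1 + i) = ∑ i ∈ Finset.range k, P (j + i) := by
    intro j
    have e := (Finset.sum_range_succ (fun i : ℕ => P (j + i)) k).symm.trans
      (Finset.sum_range_succ' (fun i : ℕ => P (j + i)) k)
    rw [hP, Nat.cast_zero, add_zero, add_left_inj] at e
    rw [e]
    exact Finset.sum_congr rfl fun i _ => by congr 1; push_cast; ring
  induction j using Int.induction_on with
  | zero => simp
  | succ n ih => rw [step, ih]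
  | pred n ih => rw [← step, sub_add_cancel, ih]

theorem IsSmallData.isCauchyHeine (S : IsSmallData k μ β r ν φ α B R L ρ)
    (hN : IsSmallCollection k β r ν ρ N) :
    IsCauchyHeine k μ β r ν (ENNReal.ofReal ρ) N φ (cauchyHeineSum k μ β r ν N φ) := by
  intro j p hp δ hδ h1 h2
  rw [sectorDom_eq] at hp
  set Q : ℤ → ℝ → ℂ := fun ℓ =>
    cauchyHeineIntegrand k μ r ν N φ ℓ (δ (ℓ : ZMod k)) (exp p.1) p.2 with hQ
  -- Periodicity exchanges the representatives `0, …, k-1` of the definition for `j, …, j+k-1`, for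
  -- which the paths lie between the arguments of `w` and `w + 2πi`.
  have hper : ∀ ℓ, Q (ℓ + k) = Q ℓ := fun ℓ => by
    have : ((ℓ + k : ℤ) : ZMod k) = ℓ := by simp
    simp only [hQ, this]
    exact S.cauchyHeineIntegrand_add hN ℓ (hδ _) hp.2 p.1
  have hc : ∀ i < k, saddleDirection k (j + i) + δ ((j + i : ℤ) : ZMod k) ∈
      Ioo (spiralArg r ν p.1) (spiralArg r ν p.1 + 2 * Real.pi) := fun i hi =>
    saddleDirection_add_mem S.hk S.hβ hi δ hδ hp.1 h1 h2
  have hc' : ∀ i : ℕ, saddleDirection k (j + i) + δ ((j + i : ℤ) : ZMod k) ∈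
      Ioo (saddleDirection k (j + i) - β) (saddleDirection k (j + i) + β) := fun i => by
    have := abs_lt.1 (hδ ((j + i : ℤ) : ZMod k))
    constructor <;> linarith
  have hint : ∀ i < k, Integrable (Q (j + i)) := fun i hi => by
    have := ((S.isDecaying hN (j + i) hp.2).integrable_mul_kernel S.hα S.hβ0 (hc' i)
      (hc i hi)).const_mul (exp p.1)⁻¹
    exact this.congr (Eventually.of_forall fun t => (cauchyHeineIntegrand_eq ..).symm)
  have hkZ : (0 : ℤ) < k := by exact_mod_cast S.hk
  refine ⟨fun ℓ _ => ?_, ?_⟩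
  · have h3 := Int.emod_nonneg (ℓ - j) hkZ.ne'
    have h4 := Int.emod_lt_of_pos (ℓ - j) hkZ
    have h5 : Q ℓ = Q (j + ((ℓ - j) % k).toNat) := by
      have h6 : (ℓ : ℤ) = j + ((ℓ - j) % k).toNat + ((ℓ - j) / k) * k := by
        rw [Int.toNat_of_nonneg h3]
        linarith [Int.emod_add_mul_ediv (ℓ - j) k, mul_comm ((ℓ - j) / (k : ℤ)) k]
      conv_lhs => rw [h6]
      have := Function.Periodic.int_mul (f := Q) (c := (k : ℤ)) hper ((ℓ - j) / k)
        (j + ((ℓ - j) % k).toNat)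
      simpa using this
    have := hint ((ℓ - j) % k).toNat (by omega)
    rw [← h5] at this
    simpa [hQ] using this
  · have e1 : ∀ i ∈ Finset.range k, cauchyHeine r ν β (saddleDirection k (j + i))
        (fun ζ => φ ((j + i : ℤ) : ZMod k) (firstIntegral k μ N (j + i) (ζ, p.2))) p.1 =
        exp p.1 / (2 * I * Real.pi) * ∫ t, Q (j + i) t := fun i hi => by
      rw [cauchyHeine_eq S.hβ0 S.hα (S.isDecaying hN (j + i) hp.2) (hc' i)
        (hc i (Finset.mem_range.1 hi)), spiralIntegral]
      simp only [hQ, cauchyHeineIntegrand_eq, integral_const_mul]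
      have := exp_ne_zero p.1
      field_simp
    rw [cauchyHeineSum, Finset.sum_congr rfl e1, ← Finset.mul_sum,
      sum_range_add_of_periodic (P := fun ℓ => ∫ t, Q ℓ t) fun ℓ => by rw [hper]]
    simp [hQ]

end

/-! ### The iteration and its limit -/

/-- The iteration `N_0 = 0`, `N_{n+1} = Σ(N_n, φ)`. -/
def cauchyHeineSeq (k : ℕ) (μ : ℂ) (β r ν : ℝ) (φ : ZMod k → ℂ → ℂ) : ℕ → ℤ → ℂ × ℂ → ℂ
  | 0 => 0
  | n + 1 => cauchyHeineSum k μ β r ν (cauchyHeineSeq k μ β r ν φ n) φ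

/-- The limit of the iteration, written as a telescoping series. -/
def cauchyHeineLimit (k : ℕ) (μ : ℂ) (β r ν : ℝ) (φ : ZMod k → ℂ → ℂ) (j : ℤ) (p : ℂ × ℂ) : ℂ :=
  ∑' n, (cauchyHeineSeq k μ β r ν φ (n + 1) j p - cauchyHeineSeq k μ β r ν φ n j p)

/-- Small data for which the refined Cauchy-Heine transform is a contraction of ratio `q`. -/
structure IsContractingData (k : ℕ) (μ : ℂ) (β r ν : ℝ) (φ : ZMod k → ℂ → ℂ)
    (α B R L ρ C q : ℝ) : Prop extends IsSmallData k μ β r ν φ α B R L ρ where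
  norm_cauchyHeine_le : ∀ (c M : ℝ) (g : ℂ → ℂ) (w : ℂ), IsDecaying r ν β c α M g →
    w ∈ strip r ν (c - β - 2 * Real.pi) (c + β) → ‖cauchyHeine r ν β c g w‖ ≤ C * M
  hq_eq : q = k * (C * (L * (3 * B * ρ)))
  hq0 : 0 ≤ q
  hq1 : q < 1

namespace IsContractingData

variable {k : ℕ} {μ : ℂ} {β r ν : ℝ} {φ : ZMod k → ℂ → ℂ} {α B R L ρ C q : ℝ}

lemma isSmallCollection (S : IsContractingData k μ β r ν φ α B R L ρ C q) (n : ℕ) :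
    IsSmallCollection k β r ν ρ (cauchyHeineSeq k μ β r ν φ n) := by
  induction n with
  | zero =>
    exact ⟨fun j => differentiableOn_const 0, fun j p _ => by simp [cauchyHeineSeq],
      fun j p _ => rfl⟩
  | succ n ih =>
    exact ⟨S.differentiableOn_cauchyHeineSum ih, fun j p hp =>
      (S.norm_cauchyHeineSum_le S.norm_cauchyHeine_le ih hp).trans (S.hq_eq ▸ S.hq1.le),
      fun j p hp => S.cauchyHeineSum_add ih hp⟩

lemma norm_seq_le (S : IsContractingData k μ β r ν φ α B R L ρ C q) (n : ℕ) {j : ℤ} {p : ℂ × ℂ}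
    (hp : p ∈ sector k β r ν j ×ˢ Metric.ball (0 : ℂ) ρ) :
    ‖cauchyHeineSeq k μ β r ν φ n j p‖ ≤ q := by
  cases n with
  | zero => simpa [cauchyHeineSeq] using S.hq0
  | succ n =>
    rw [S.hq_eq]
    exact S.norm_cauchyHeineSum_le S.norm_cauchyHeine_le (S.isSmallCollection n) hp

lemma norm_seq_succ_sub_le (S : IsContractingData k μ β r ν φ α B R L ρ C q) (n : ℕ) :
    ∀ j, ∀ p ∈ sector k β r ν j ×ˢ Metric.ball (0 : ℂ) ρ,
      ‖cauchyHeineSeq k μ β r ν φ (n + 1) j p - cauchyHeineSeq k μ β r ν φ n j p‖ ≤ q * q ^ n := by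
  induction n with
  | zero =>
    intro j p hp
    simpa [cauchyHeineSeq] using S.norm_seq_le 1 hp
  | succ n ih =>
    intro j p hp
    have := S.norm_cauchyHeineSum_sub_le S.norm_cauchyHeine_le (S.isSmallCollection (n + 1))
      (S.isSmallCollection n) ih hp
    rw [← S.hq_eq] at this
    rw [pow_succ']
    exact this

lemma hasSum_limit (S : IsContractingData k μ β r ν φ α B R L ρ C q) {j : ℤ} {p : ℂ × ℂ}
    (hp : p ∈ sector k β r ν j ×ˢ Metric.ball (0 : ℂ) ρ) :
    HasSum (fun n => cauchyHeineSeq k μ β r ν φ (n + 1) j p - cauchyHeineSeq k μ β r ν φ n j p)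
      (cauchyHeineLimit k μ β r ν φ j p) :=
  (Summable.of_norm_bounded ((summable_geometric_of_lt_one S.hq0 S.hq1).mul_left q)
    fun n => S.norm_seq_succ_sub_le n j p hp).hasSum

lemma sum_range_seq_sub (n : ℕ) (j : ℤ) (p : ℂ × ℂ) :
    ∑ i ∈ Finset.range n,
      (cauchyHeineSeq k μ β r ν φ (i + 1) j p - cauchyHeineSeq k μ β r ν φ i j p) =
        cauchyHeineSeq k μ β r ν φ n j p := by
  rw [Finset.sum_range_sub (fun i => cauchyHeineSeq k μ β r ν φ i j p)]
  simp [cauchyHeineSeq]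

lemma tendstoUniformlyOn_limit (S : IsContractingData k μ β r ν φ α B R L ρ C q) (j : ℤ) :
    TendstoUniformlyOn (fun n => cauchyHeineSeq k μ β r ν φ n j) (cauchyHeineLimit k μ β r ν φ j)
      atTop (sector k β r ν j ×ˢ Metric.ball (0 : ℂ) ρ) := by
  have h := tendstoUniformlyOn_tsum_nat ((summable_geometric_of_lt_one S.hq0 S.hq1).mul_left q)
    fun n p hp => S.norm_seq_succ_sub_le n j p hp
  simp only [sum_range_seq_sub] at h
  exact h

lemma tendsto_limit (S : IsContractingData k μ β r ν φ α B R L ρ C q) {j : ℤ} {p : ℂ × ℂ}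
    (hp : p ∈ sector k β r ν j ×ˢ Metric.ball (0 : ℂ) ρ) :
    Tendsto (fun n => cauchyHeineSeq k μ β r ν φ n j p) atTop
      (𝓝 (cauchyHeineLimit k μ β r ν φ j p)) :=
  (S.tendstoUniformlyOn_limit j).tendsto_at hp

lemma norm_limit_le (S : IsContractingData k μ β r ν φ α B R L ρ C q) {j : ℤ} {p : ℂ × ℂ}
    (hp : p ∈ sector k β r ν j ×ˢ Metric.ball (0 : ℂ) ρ) :
    ‖cauchyHeineLimit k μ β r ν φ j p‖ ≤ q :=
  le_of_tendsto (S.tendsto_limit hp).norm (Eventually.of_forall fun n => S.norm_seq_le n hp)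

lemma isSmallCollection_limit (S : IsContractingData k μ β r ν φ α B R L ρ C q) :
    IsSmallCollection k β r ν ρ (cauchyHeineLimit k μ β r ν φ) where
  holomorphic j := differentiableOn_of_geometric_bound
    ((isOpen_sector k β r ν j).prod Metric.isOpen_ball) S.hq0 S.hq1
    (fun n => ((S.isSmallCollection (n + 1)).holomorphic j).sub
      ((S.isSmallCollection n).holomorphic j))
    (fun n p hp => S.norm_seq_succ_sub_le n j p hp) (fun p hp => S.hasSum_limit hp)
  norm_le j p hp := (S.norm_limit_le hp).trans S.hq1.le
  periodic j p hp := by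
    simp only [cauchyHeineLimit]
    congr 1; ext n
    rw [(S.isSmallCollection (n + 1)).periodic j p hp, (S.isSmallCollection n).periodic j p hp]

/-- The jump of `N_{n+1}` is `φ^j(H_{N_n}^j)`; continuity of `φ^j` lets `n → ∞` without first
showing that the limit is a fixed point of `Σ`. -/
lemma limit_jump (S : IsContractingData k μ β r ν φ α B R L ρ C q) {j : ℤ} {p : ℂ × ℂ}
    (hp : p ∈ saddlePart k β r ν j ×ˢ Metric.ball (0 : ℂ) ρ) :
    cauchyHeineLimit k μ β r ν φ (j + 1) p - cauchyHeineLimit k μ β r ν φ j p =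
      φ j (firstIntegral k μ (cauchyHeineLimit k μ β r ν φ) j p) := by
  have h1 := S.tendsto_limit (j := j) ⟨hp.1.1, hp.2⟩
  have h2 := S.tendsto_limit (j := j + 1) ⟨hp.1.2, hp.2⟩
  have h3 : Tendsto (fun n => firstIntegral k μ (cauchyHeineSeq k μ β r ν φ n) j p) atTop
      (𝓝 (firstIntegral k μ (cauchyHeineLimit k μ β r ν φ) j p)) := by
    simp only [firstIntegral_eq]
    exact h1.cexp.const_mul _
  have h4 : ContinuousAt (φ j) (firstIntegral k μ (cauchyHeineLimit k μ β r ν φ) j p) :=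
    ((S.differentiableOn j).differentiableAt (Metric.isOpen_ball.mem_nhds
      (S.firstIntegral_mem S.isSmallCollection_limit hp))).continuousAt
  refine tendsto_nhds_unique (((tendsto_add_atTop_iff_nat 1).2 h2).sub
    ((tendsto_add_atTop_iff_nat 1).2 h1)) ((h4.tendsto.comp h3).congr fun n => ?_)
  exact (S.cauchyHeineSum_jump (S.isSmallCollection n) hp).symm

end IsContractingData

/-! ### Restriction to smaller domains, choice of the radii and derivative bounds -/

lemma supNorm_lt_of_le {E : Type*} {D : ℤ → Set E} {F : ℤ → E → ℂ} {a : ℝ} {b : ℝ≥0∞}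
    (h : ∀ j, ∀ p ∈ D j, ‖F j p‖ ≤ a) (hb : ENNReal.ofReal a < b) : supNorm D F < b := by
  refine lt_of_le_of_lt (iSup_le fun j => iSup₂_le fun p hp => ?_) hb
  rw [← ofReal_norm]
  exact ENNReal.ofReal_le_ofReal (h j p hp)

lemma sector_mono {k : ℕ} {β β' : ℝ} (h : β ≤ β') (r ν : ℝ) (j : ℤ) :
    sector k β r ν j ⊆ sector k β' r ν j := by
  rw [sector_eq, sector_eq]
  exact strip_mono (by linarith) (by linarith)

lemma saddlePart_mono {k : ℕ} {β β' : ℝ} (h : β ≤ β') (r ν : ℝ) (j : ℤ) :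
    saddlePart k β r ν j ⊆ saddlePart k β' r ν j :=
  inter_subset_inter (sector_mono h r ν j) (sector_mono h r ν (j + 1))

lemma IsSmallCollection.isAdapted {k : ℕ} {μ : ℂ} {β β' r ν ρ ρ' α B R L : ℝ}
    {φ : ZMod k → ℂ → ℂ} {Δ : ZMod k → Set ℂ} {N : ℤ → ℂ × ℂ → ℂ}
    (S : IsSmallData k μ β' r ν φ α B R L ρ') (hN : IsSmallCollection k β' r ν ρ' N)
    (hΔ : ∀ j, Metric.ball 0 R ⊆ Δ j) (hβ : β ≤ β') (hρ : 0 < ρ) (hρ' : ρ ≤ ρ') :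
    IsAdapted k μ β r ν Δ (ENNReal.ofReal ρ) N := by
  have hsub : ∀ j, sectorDom k β r ν (ENNReal.ofReal ρ) j ⊆
      sector k β' r ν j ×ˢ Metric.ball (0 : ℂ) ρ' := fun j => by
    rw [sectorDom_eq]
    exact prod_mono (sector_mono hβ r ν j) (Metric.ball_subset_ball hρ')
  refine ⟨ENNReal.ofReal_pos.2 hρ, ⟨fun j => (hN.holomorphic j).mono (hsub j), ?_,
    fun j p hp => hN.periodic j p (hsub j hp)⟩, fun j p hp => ?_⟩
  · exact supNorm_lt_of_le (fun j p hp => hN.norm_le j p (hsub j hp)) (by simp)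
  · rw [saddleDom_eq] at hp
    exact hΔ _ (S.firstIntegral_mem hN
      ⟨saddlePart_mono hβ r ν j hp.1, Metric.ball_subset_ball hρ' hp.2⟩)

lemma IsCauchyHeine.mono {k : ℕ} {μ : ℂ} {β β' r ν : ℝ} {ρ ρ' : ℝ≥0∞} {φ : ZMod k → ℂ → ℂ}
    {N S : ℤ → ℂ × ℂ → ℂ} (h : IsCauchyHeine k μ β' r ν ρ' N φ S) (hβ : β ≤ β') (hρ : ρ ≤ ρ') :
    IsCauchyHeine k μ β r ν ρ N φ S := fun j p hp δ hδ h1 h2 =>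
  h j p ⟨sector_mono hβ r ν j hp.1, hp.2.trans_le hρ⟩ δ (fun ℓ => (hδ ℓ).trans_le hβ) h1 h2

lemma exists_isSmallData_radius {k : ℕ} (hk : 0 < k) {Δ : ZMod k → Set ℂ} (hΔ : IsAdmissible Δ)
    {φ : ZMod k → ℂ → ℂ} (hφ : MemBPrime Δ φ) : ∃ R L : ℝ, 0 < R ∧ 0 ≤ L ∧
      (∀ j, Metric.ball 0 R ⊆ Δ j) ∧ (∀ j, DifferentiableOn ℂ (φ j) (Metric.ball 0 R)) ∧
      ∀ j, ∀ h ∈ Metric.ball (0 : ℂ) R, ∀ h' ∈ Metric.ball (0 : ℂ) R,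
        ‖φ j h - φ j h'‖ ≤ L * ‖h - h'‖ := by
  have : NeZero k := ⟨hk.ne'⟩
  have hev : ∀ᶠ R in 𝓝[>] (0 : ℝ), 0 < R ∧ ∀ j, Metric.ball 0 R ⊆ Δ j := by
    refine (eventually_mem_nhdsWithin (a := (0 : ℝ)) (s := Ioi 0)).and
      (eventually_all.2 fun j => ?_)
    obtain ⟨ε, hε, hε'⟩ := Metric.isOpen_iff.1 (hΔ j).1 0 (hΔ j).2.2
    filter_upwards [Ioo_mem_nhdsGT hε] with R hR
    exact (Metric.ball_subset_ball hR.2.le).trans hε'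
  obtain ⟨R, hR, hRΔ⟩ := hev.exists
  choose c hc using fun j => (hφ j).2.2
  obtain ⟨K, hK⟩ := (finite_range c).bddAbove
  have hcK : ∀ j, c j ≤ max K 0 := fun j => (hK ⟨j, rfl⟩).trans (le_max_left _ _)
  have hK0 : 0 ≤ max K 0 := le_max_right _ _
  have hsub : Metric.ball (0 : ℂ) (R / 2) ⊆ Metric.ball 0 R := Metric.ball_subset_ball (by linarith)
  have hd : ∀ j, DifferentiableOn ℂ (φ j) (Metric.ball 0 R) := fun j => (hφ j).1.mono (hRΔ j)
  -- On the disc of radius `R` one has `|φ^j| ≤ max K 0 · R`; halving the radius turns this into a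
  -- bound of the derivative, hence a Lipschitz constant.
  refine ⟨R / 2, 4 * (max K 0 * R) / R, half_pos hR, by positivity,
    fun j => hsub.trans (hRΔ j), fun j => (hd j).mono hsub, fun j h hh h' hh' => ?_⟩
  refine (convex_ball (0 : ℂ) (R / 2)).norm_image_sub_le_of_norm_fderiv_le (𝕜 := ℂ)
    (fun x hx => (hd j).differentiableAt (Metric.isOpen_ball.mem_nhds (hsub hx)))
    (fun x hx => norm_fderiv_le_of_norm_le hR (hd j) (fun z hz => ?_) hx) hh' hh
  refine (hc j z (hRΔ j hz)).trans ?_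
  exact mul_le_mul (hcK j) (mem_ball_zero_iff.1 hz).le (norm_nonneg _) hK0

lemma norm_mul_partialY_le {k : ℕ} {β r ν ρ q : ℝ} {j : ℤ} {F : ℂ × ℂ → ℂ} (hρ : 0 < ρ)
    (hF : DifferentiableOn ℂ F (sector k β r ν j ×ˢ Metric.ball 0 ρ))
    (hq : ∀ p ∈ sector k β r ν j ×ˢ Metric.ball (0 : ℂ) ρ, ‖F p‖ ≤ q) {p : ℂ × ℂ}
    (hp : p ∈ sector k β r ν j ×ˢ Metric.ball (0 : ℂ) (ρ / 2)) :
    ‖p.2 * partialY F p‖ ≤ 2 * q := by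
  have hy : ‖p.2‖ < ρ / 2 := mem_ball_zero_iff.1 hp.2
  have hsub : ∀ y ∈ Metric.closedBall p.2 (ρ / 4),
      (p.1, y) ∈ sector k β r ν j ×ˢ Metric.ball (0 : ℂ) ρ := fun y hy' => by
    refine ⟨hp.1, mem_ball_zero_iff.2 ?_⟩
    have := norm_sub_norm_le y p.2
    have := mem_closedBall_iff_norm.1 hy'
    linarith
  have hq0 : 0 ≤ q := (norm_nonneg _).trans
    (hq _ (hsub p.2 (Metric.mem_closedBall_self (by positivity))))
  have h := norm_deriv_le_of_forall_mem_sphere_norm_le (f := fun y => F (p.1, y)) (c := p.2)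
    (R := ρ / 4) (C := q) (by positivity)
    ((hF.comp (f := fun y : ℂ => (p.1, y)) (by fun_prop)
      fun y hy => hsub y hy).diffContOnCl_ball subset_rfl)
    (fun y hy => hq _ (hsub y (Metric.sphere_subset_closedBall hy)))
  rw [norm_mul, partialY]
  calc ‖p.2‖ * ‖deriv (fun y => F (p.1, y)) p.2‖ ≤ ρ / 2 * (q / (ρ / 4)) := by gcongr
    _ = 2 * q := by field_simp; ring

lemma norm_mul_partialX_le {k : ℕ} {β β' r ν ρ q d : ℝ} {j : ℤ} {F : ℂ × ℂ → ℂ} (hd : 0 < d)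
    (hββ' : β + (1 + |ν|) * d ≤ β')
    (hF : DifferentiableOn ℂ F (sector k β' r ν j ×ˢ Metric.ball 0 ρ))
    (hq : ∀ p ∈ sector k β' r ν j ×ˢ Metric.ball (0 : ℂ) ρ, ‖F p‖ ≤ q) {p : ℂ × ℂ}
    (hp : p ∈ sector k β r ν j ×ˢ Metric.ball (0 : ℂ) ρ) :
    ‖exp p.1 * partialX F p‖ ≤ q / d := by
  have hsub : ∀ w ∈ Metric.closedBall p.1 d,
      (w, p.2) ∈ sector k β' r ν j ×ˢ Metric.ball (0 : ℂ) ρ := fun w hw => by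
    refine ⟨?_, hp.2⟩
    have h1 : |spiralArg r ν p.1 - direction k j| < Real.pi / k + β := hp.1
    have h2 := (abs_spiralArg_sub_le r ν w p.1).trans
      (mul_le_mul_of_nonneg_left (mem_closedBall_iff_norm.1 hw) (by positivity))
    have h3 := abs_sub_le (spiralArg r ν w) (spiralArg r ν p.1) (direction k j)
    change |spiralArg r ν w - direction k j| < Real.pi / k + β'
    linarith
  rw [partialX, ← mul_assoc, mul_inv_cancel₀ (exp_ne_zero _), one_mul]
  exact norm_deriv_le_of_forall_mem_sphere_norm_le (f := fun w => F (w, p.2)) (c := p.1)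
    (R := d) (C := q) hd
    ((hF.comp (f := fun w : ℂ => (w, p.2)) (by fun_prop)
      fun w hw => hsub w hw).diffContOnCl_ball subset_rfl)
    (fun w hw => hq _ (hsub w (Metric.sphere_subset_closedBall hw)))

theorem exists_isContractingData {k : ℕ} (hk : 0 < k) {μ : ℂ} {β r ν : ℝ} (hβ0 : 0 < β)
    (hβ : β < Real.pi / (2 * k)) (hν : ν * μ.im < μ.re)
    {Δ : ZMod k → Set ℂ} (hΔ : IsAdmissible Δ) {φ : ZMod k → ℂ → ℂ} (hφ : MemBPrime Δ φ)
    {ε : ℝ} (hε : 0 < ε) (hε1 : ε < 1) : ∃ α B R L ρ C q,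
      IsContractingData k μ β r ν φ α B R L ρ C q ∧ q ≤ ε ∧ ∀ j, Metric.ball 0 R ⊆ Δ j := by
  have hα : 0 < μ.re - ν * μ.im := sub_pos.2 hν
  have hk1 : (1 : ℝ) ≤ k := by exact_mod_cast hk
  obtain ⟨B, hB, hBE⟩ := exists_norm_modelIntegral_le hk r hβ0 hβ hν
  obtain ⟨R, L, hR, hL, hRΔ, hd, hlip⟩ := exists_isSmallData_radius hk hΔ hφ
  obtain ⟨C, hC, hCE⟩ := exists_norm_cauchyHeine_le r ν hβ0
    (hβ.le.trans (div_le_self Real.pi_pos.le (by linarith))) hα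
  set K := k * (C * (L * (3 * B))) with hK
  have hK0 : 0 ≤ K := by positivity
  set m := min ε R with hm
  have hm0 : 0 < m := lt_min hε hR
  -- One choice ensures both `Kρ ≤ ε` and `3Bρ < R`; the summand `1` keeps the denominator positive
  -- and the second inequality strict.
  set ρ := m / (K + 3 * B + 1) with hρ
  have hρ0 : 0 < ρ := by positivity
  have hρm : (K + 3 * B + 1) * ρ = m := by rw [hρ]; field_simp
  have hBρ : 0 ≤ B * ρ := by positivity
  have hKρ : 0 ≤ K * ρ := by positivity
  have hq : k * (C * (L * (3 * B * ρ))) = K * ρ := by rw [hK]; ring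
  have hqε : K * ρ ≤ ε := by linarith [min_le_left ε R]
  refine ⟨_, B, R, L, ρ, C, K * ρ, ⟨⟨hk, hβ0, hβ, hα, hB, hL, hρ0, hBE, ?_, hd,
    fun j => (hφ j).2.1, hlip⟩, hCE, hq.symm, hKρ, hqε.trans_lt hε1⟩, hqε, hRΔ⟩
  linarith [min_le_right ε R]

end SaddleNode

end

/-! ### The proposition -/

open SaddleNode in
theorem mainTheorem4 (k : ℕ) (hk : 0 < k) (μ : ℂ) (β r ν : ℝ)
    (hβ_pos : 0 < β) (hβ : β < Real.pi / (2 * k)) (hr : 0 < r) (hν : ν * μ.im < μ.re)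
    (Δ : ZMod k → Set ℂ) (hΔ : IsAdmissible Δ)
    (φ : ZMod k → ℂ → ℂ) (hφ : MemBPrime Δ φ) :
    ∃ (ρ : ℝ≥0∞) (N : ℤ → ℂ × ℂ → ℂ),
      ρ < ⊤ ∧ IsAdapted k μ β r ν Δ ρ N ∧
      (∀ j : ℤ, ∀ p ∈ saddleDom k β r ν ρ j,
        firstIntegral k μ N (j + 1) p =
          firstIntegral k μ N j p *
            Complex.exp (2 * Complex.I * Real.pi * μ / k +
              φ (j : ZMod k) (firstIntegral k μ N j p))) ∧
      supNorm (sectorDom k β r ν ρ) (fun j p => p.2 * partialY (N j) p) < 1 ∧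
      supNorm (sectorDom k β r ν ρ) (fun j p => Complex.exp p.1 * partialX (N j) p) < 1 ∧
      ∃ Nseq : ℕ → ℤ → ℂ × ℂ → ℂ,
        Nseq 0 = 0 ∧
        (∀ n, IsAdapted k μ β r ν Δ ρ (Nseq n)) ∧
        (∀ n, IsCauchyHeine k μ β r ν ρ (Nseq n) φ (Nseq (n + 1))) ∧
        ∀ j, TendstoLocallyUniformlyOn (fun n => Nseq n j) (N j) Filter.atTop
          (sectorDom k β r ν ρ j) := by
  -- The construction takes place on the wider sectors of parameter `β'`; discs of radius `d` in the
  -- `log` plane centred in the original sectors stay inside them.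
  obtain ⟨β', hββ', hβ'⟩ := exists_between hβ
  obtain ⟨d, hd⟩ : ∃ d, d = (β' - β) / (1 + |ν|) := ⟨_, rfl⟩
  have hd0 : 0 < d := by rw [hd]; exact div_pos (sub_pos.2 hββ') (by positivity)
  have hdν : β + (1 + |ν|) * d = β' := by
    have : 1 + |ν| ≠ 0 := by positivity
    rw [hd]; field_simp; ring
  -- Cauchy's estimates give `2q` for `y ∂N/∂y` on the half radius and `q/d` for `x ∂N/∂x`; the two
  -- entries of the minimum make both less than `1`.
  obtain ⟨α, B, R, L, ρ, C, q, S, hq, hRΔ⟩ := exists_isContractingData (r := r) hk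
    (hβ_pos.trans hββ') hβ' hν hΔ hφ (ε := min (1 / 4) (d / 2)) (by positivity)
    (lt_of_le_of_lt (min_le_left _ _) (by norm_num))
  have hq4 : q ≤ 1 / 4 := hq.trans (min_le_left _ _)
  have hqd : q ≤ d / 2 := hq.trans (min_le_right _ _)
  have hρ := S.hρ
  have hsub : ∀ j, sectorDom k β r ν (ENNReal.ofReal (ρ / 2)) j ⊆
      sector k β' r ν j ×ˢ Metric.ball (0 : ℂ) ρ := fun j => by
    rw [sectorDom_eq]
    exact Set.prod_mono (sector_mono hββ'.le r ν j) (Metric.ball_subset_ball (by linarith))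
  refine ⟨ENNReal.ofReal (ρ / 2), cauchyHeineLimit k μ β' r ν φ, ENNReal.ofReal_lt_top,
    S.isSmallCollection_limit.isAdapted S.toIsSmallData hRΔ hββ'.le (by positivity) (by linarith),
    fun j p hp => ?_, ?_, ?_, cauchyHeineSeq k μ β' r ν φ, rfl,
    fun n => (S.isSmallCollection n).isAdapted S.toIsSmallData hRΔ hββ'.le (by positivity)
      (by linarith),
    fun n => (S.isCauchyHeine (S.isSmallCollection n)).mono hββ'.le
      (ENNReal.ofReal_le_ofReal (by linarith)),
    fun j => ((S.tendstoUniformlyOn_limit j).mono (hsub j)).tendstoLocallyUniformlyOn⟩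
  · rw [saddleDom_eq] at hp
    have h := S.limit_jump (j := j) (p := p)
      ⟨saddlePart_mono hββ'.le r ν j hp.1, Metric.ball_subset_ball (by linarith) hp.2⟩
    rw [← h]
    simp only [firstIntegral, mul_assoc, ← Complex.exp_add]
    congr 2
    push_cast; ring
  · refine supNorm_lt_of_le (a := 2 * q) (fun j p hp => ?_)
      (by rw [ENNReal.ofReal_lt_one]; linarith)
    rw [sectorDom_eq] at hp
    exact norm_mul_partialY_le hρ (S.isSmallCollection_limit.holomorphic j)
      (fun p hp => S.norm_limit_le hp) ⟨sector_mono hββ'.le r ν j hp.1, hp.2⟩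
  · refine supNorm_lt_of_le (a := q / d) (fun j p hp => ?_)
      (by rw [ENNReal.ofReal_lt_one, div_lt_one hd0]; linarith)
    rw [sectorDom_eq] at hp
    exact norm_mul_partialX_le hd0 hdν.le (S.isSmallCollection_limit.holomorphic j)
      (fun p hp => S.norm_limit_le hp) ⟨hp.1, Metric.ball_subset_ball (by linarith) hp.2⟩
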